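/- Let $n$, $m$ and $k$ be positive integers. Then there are infinitely many pairwise inequivalent virtual links with exactly $k$ components whose unknotting index equals $(n,m)$. Here the unknotting index $U(L)$ of a virtual link $L$ is the least pair $(a,b)$ of non-negative integers, with respect to the dictionary order, such that some diagram of $L$ can be turned into a diagram of the trivial link by virtualizing $a$ classical crossings (replacing them by virtual crossings) and changing $b$ other classical crossings. Two virtual links are equivalent if their diagrams are related by classical and virtual Reidemeister moves. -/

import Mathlib

/-- A Gauss diagram on `k` oriented circles, that is, an oriented virtual link diagram with `k`
components, up to planar isotopy and detour moves of its virtual crossings.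
Classical crossings (chords) are named by natural numbers. `word i` lists, in the cyclic order in
which one meets them on the `i`-th component, the passages through the classical crossings:
`(c, true)` is the passage over the crossing `c` and `(c, false)` the passage under it.
`sgn c` is the sign of the crossing `c` (irrelevant if `c` does not occur in the diagram).
Virtual crossings are not recorded. -/
structure GaussDiagram (k : ℕ) where
  word : Fin k → List (ℕ × Bool)
  sgn : ℕ → ℤˣ
  nodup : ∀ i, (word i).Nodup
  disjoint : ∀ i j a, a ∈ word i → a ∈ word j → i = j
  paired : ∀ i c b, (c, b) ∈ word i → ∃ j, (c, !b) ∈ word j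

namespace GaussDiagram

variable {k : ℕ}

/-- The set of classical crossings of a diagram. -/
def crossings (D : GaussDiagram k) : Finset ℕ :=
  Finset.univ.biUnion fun i => ((D.word i).map Prod.fst).toFinset

/-- The diagram of the trivial `k`-component link: `k` circles without crossings. -/
def trivial (k : ℕ) : GaussDiagram k where
  word _ := []
  sgn _ := 1
  nodup _ := List.nodup_nil
  disjoint _ _ _ h := by simp at h
  paired _ _ _ h := by simp at h

/-- Virtualization of the crossings in `S`: a classical crossing that becomes virtual is
erased from the Gauss diagram. -/
def virtualize (D : GaussDiagram k) (S : Finset ℕ) : GaussDiagram k where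
  word i := (D.word i).filter fun a => a.1 ∉ S
  sgn := D.sgn
  nodup i := (D.nodup i).filter _
  disjoint i j a hi hj := D.disjoint i j a (List.mem_of_mem_filter hi) (List.mem_of_mem_filter hj)
  paired i c b h := by
    rw [List.mem_filter] at h
    obtain ⟨j, hj⟩ := D.paired i c b h.1
    exact ⟨j, List.mem_filter.2 ⟨hj, h.2⟩⟩

/-- Exchange of over- and under-passage at the crossings in `T`. -/
def flip (T : Finset ℕ) (a : ℕ × Bool) : ℕ × Bool :=
  if a.1 ∈ T then (a.1, !a.2) else a

theorem flip_flip (T : Finset ℕ) (a : ℕ × Bool) : flip T (flip T a) = a := by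
  unfold flip
  by_cases h : a.1 ∈ T <;> simp [h]

theorem mem_map_flip (T : Finset ℕ) (l : List (ℕ × Bool)) (a : ℕ × Bool) :
    a ∈ l.map (flip T) ↔ flip T a ∈ l := by
  rw [List.mem_map]
  constructor
  · rintro ⟨b, hb, rfl⟩
    rwa [flip_flip]
  · intro h
    exact ⟨_, h, flip_flip T a⟩

theorem flip_not (T : Finset ℕ) (c : ℕ) (b : Bool) :
    flip T (c, !b) = ((flip T (c, b)).1, !(flip T (c, b)).2) := by
  unfold flip
  by_cases h : c ∈ T <;> simp [h]

/-- Crossing change at the crossings in `T`: over- and under-passage are exchanged and the sign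
changes. -/
def crossingChange (D : GaussDiagram k) (T : Finset ℕ) : GaussDiagram k where
  word i := (D.word i).map (flip T)
  sgn c := if c ∈ T then -D.sgn c else D.sgn c
  nodup i := (D.nodup i).map (Function.LeftInverse.injective (flip_flip T))
  disjoint i j a hi hj :=
    D.disjoint i j (flip T a) ((mem_map_flip T _ a).1 hi) ((mem_map_flip T _ a).1 hj)
  paired i c b h := by
    obtain ⟨j, hj⟩ := D.paired i _ _ ((mem_map_flip T _ _).1 h)
    exact ⟨j, (mem_map_flip T _ _).2 (by rw [flip_not]; exact hj)⟩

/-- On some component the passage `a` is immediately followed by the passage `b`. -/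
def Adj (D : GaussDiagram k) (a b : ℕ × Bool) : Prop :=
  ∃ i t, D.word i ~r (a :: b :: t)

/-- The passages `a` and `b` are consecutive, in the order `a, b` if `e = 1` and in the order
`b, a` if `e = -1`. -/
def AdjBy (D : GaussDiagram k) (e : ℤˣ) (a b : ℕ × Bool) : Prop :=
  if e = 1 then D.Adj a b else D.Adj b a

/-- Two Gauss diagrams are the same up to the numbering of the components, the names of the
crossings and the base points on the components. -/
def Iso (D D' : GaussDiagram k) : Prop :=
  ∃ (σ : Equiv.Perm (Fin k)) (f : Equiv.Perm ℕ),
    (∀ i, D'.word (σ i) ~r (D.word i).map (Prod.map f id)) ∧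
      ∀ c ∈ D.crossings, D'.sgn (f c) = D.sgn c

/-- The Reidemeister moves for Gauss diagrams.

* `r1`: a crossing whose two passages are consecutive is removed.
* `r2`: two crossings of opposite signs whose over-passages are consecutive and whose
  under-passages are consecutive are removed.
* `r3`: `x`, `y`, `z` are the crossings of a top strand over a middle strand, of the top strand over
  a bottom strand, and of the middle strand over the bottom strand. The two passages on each of the
  three strands are consecutive and trade places. The units `eT`, `eM`, `eB` record their orders
  before the move; the two equations between them and the signs say that the three strands form
  a triangle in the plane. -/
inductive Move : GaussDiagram k → GaussDiagram k → Prop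
  | iso (D D' : GaussDiagram k) (h : D.Iso D') : Move D D'
  | r1 (D : GaussDiagram k) (c : ℕ) (b : Bool) (h : D.Adj (c, b) (c, !b)) :
      Move D (D.virtualize {c})
  | r2 (D : GaussDiagram k) (c d : ℕ) (hcd : c ≠ d) (hs : D.sgn c = -D.sgn d)
      (ho : D.Adj (c, true) (d, true) ∨ D.Adj (d, true) (c, true))
      (hu : D.Adj (c, false) (d, false) ∨ D.Adj (d, false) (c, false)) :
      Move D (D.virtualize {c, d})
  | r3 (D D' : GaussDiagram k) (x y z : ℕ) (hxy : x ≠ y) (hxz : x ≠ z) (hyz : y ≠ z)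
      (eT eM eB : ℤˣ)
      (hT : D.AdjBy eT (x, true) (y, true))
      (hM : D.AdjBy eM (x, false) (z, true))
      (hB : D.AdjBy eB (y, false) (z, false))
      (h₁ : D.sgn x * eM = D.sgn y * eB)
      (h₂ : D.sgn z * eM = D.sgn y * eT)
      (hw : ∀ i, D'.word i = (D.word i).map
        (Equiv.swap (x, true) (y, true) * Equiv.swap (x, false) (z, true) *
          Equiv.swap (y, false) (z, false) : Equiv.Perm (ℕ × Bool)))
      (hs : D'.sgn = D.sgn) :
      Move D D'

/-- Equivalence of diagrams: the equivalence relation generated by the moves. -/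
instance setoid (k : ℕ) : Setoid (GaussDiagram k) := Relation.EqvGen.setoid Move

/-- `D` is `(n, m)`-unknottable: virtualizing `n` crossings and changing `m` other crossings turns it
into a diagram of the trivial link. -/
def Unknottable (D : GaussDiagram k) (n m : ℕ) : Prop :=
  ∃ S T : Finset ℕ, S ⊆ D.crossings ∧ T ⊆ D.crossings ∧ Disjoint S T ∧ S.card = n ∧ T.card = m ∧
    (D.crossingChange T).virtualize S ≈ trivial k

theorem unknottable_card (D : GaussDiagram k) : D.Unknottable D.crossings.card 0 := by
  refine ⟨D.crossings, ∅, subset_rfl, Finset.empty_subset _, Finset.disjoint_empty_right _, rfl, rfl,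
    ?_⟩
  have hw : ∀ i, ((D.crossingChange ∅).virtualize D.crossings).word i = [] := by
    intro i
    simp only [virtualize, crossingChange, List.filter_eq_nil_iff, List.mem_map]
    rintro a ⟨b, hb, rfl⟩
    have hc : b.1 ∈ D.crossings := by
      simp only [crossings, Finset.mem_biUnion, Finset.mem_univ, true_and, List.mem_toFinset]
      exact ⟨i, List.mem_map_of_mem hb⟩
    simpa [flip] using hc
  refine Relation.EqvGen.rel _ _ (Move.iso _ _ ⟨1, 1, fun i => ?_, fun c hc => ?_⟩)
  · rw [hw]
    exact List.IsRotated.refl _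
  · rw [crossings, Finset.mem_biUnion] at hc
    obtain ⟨i, -, hi⟩ := hc
    rw [hw] at hi
    simp at hi

/-- The unknotting index of a diagram: the least pair `(n, m)` in the dictionary order such that the
diagram is `(n, m)`-unknottable. -/
noncomputable def unknottingIndex (D : GaussDiagram k) : ℕ ×ₗ ℕ :=
  WellFounded.min (wellFounded_lt (α := ℕ ×ₗ ℕ))
    {p | D.Unknottable (ofLex p).1 (ofLex p).2}
    ⟨toLex (D.crossings.card, 0), D.unknottable_card⟩

end GaussDiagram

/-- Virtual links with `k` components (oriented, with unordered components): equivalence classes of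
diagrams. -/
def VirtualLink (k : ℕ) : Type := Quotient (GaussDiagram.setoid k)

namespace VirtualLink

variable {k : ℕ}

/-- The virtual link presented by a diagram. -/
def mk (D : GaussDiagram k) : VirtualLink k := Quotient.mk _ D

/-- The unknotting index of a virtual link: the least unknotting index, in the dictionary order, of
the diagrams that present it. -/
noncomputable def unknottingIndex (L : VirtualLink k) : ℕ ×ₗ ℕ :=
  WellFounded.min (wellFounded_lt (α := ℕ ×ₗ ℕ))
    {p | ∃ D : GaussDiagram k, mk D = L ∧ D.unknottingIndex = p}
    (by
      obtain ⟨D, hD⟩ := Quotient.exists_rep L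
      exact ⟨_, D, hD, rfl⟩)

end VirtualLink

/-! The links come from a discrete continuity argument fed by two coloring invariants; no link has
its index computed directly.

A `Switch` colors the strands of a diagram by an abelian group, with an additive rule at each
crossing that is compatible with the Reidemeister moves. For a finite group the number of colorings
is therefore a link invariant (`Switch.count_eq_of_equiv`). By additivity, forcing a crossing to act
trivially on colors is a linear condition and costs at most a fixed factor (`Switch.count_le_mul`).
This bounds the number of colorings of a diagram that is trivialized by few operations.

Two switches are used. `flatSwitch`, over the field with four elements, does not see which strand is
on top, so crossing changes are free: if `a` virtualizations suffice, there are at most `16 ^ a * 4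
^ k` flat colorings (`FlatUnknottable.count_le`). Fox colorings modulo `q` charge a factor `q` for
either operation, so an `(a, b)`-unknottable diagram has at most `q ^ (a + b + k)` of them
(`count_fox_le_of_unknottable`).

Upper bounds come from inserting long diagrams into a component. `flatClasp` dissolves after one
virtualization and at least doubles the flat count. `twistClasp r`, with `p = 4 * r + 1` prime,
dissolves after one crossing change, multiplies the Fox count modulo `p` by at least `p`, and leaves
the Fox counts modulo all other primes unchanged.

An insertion thus raises the relevant entry of the index by at most one, while the counts forbid
that entry to stay bounded under repeated insertion; so no value can be skipped. This yields a
diagram of flat index exactly `n` (`exists_flatUnknottable`), and then, with twisted clasps, which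
do not affect the flat class, a diagram of index `(n, m)` (`exists_unknottingIndex_eq`). One such
link for each prime `p` congruent to 1 modulo 4 gives infinitely many, since the Fox count modulo
`p` separates the link of `p` from those of the other primes. -/

namespace GaussDiagram

/-! ### Colors along a single strand -/

section Path

variable {α V : Type*}

/-- A strand runs through the passages in `l`, starting with the color `v` and ending with the
color `w`; `p a` and `q a` are its colors before and after the passage `a`. -/
def Path (p q : α → V) : V → List α → V → Prop
  | v, [], w => v = w
  | v, a :: l, w => p a = v ∧ Path p q (q a) l w

theorem path_append {p q : α → V} {l l' : List α} {v w : V} :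
    Path p q v (l ++ l') w ↔ ∃ u, Path p q v l u ∧ Path p q u l' w := by
  induction l generalizing v with
  | nil => simp [Path]
  | cons a l ih => simp only [List.cons_append, Path, ih]; tauto

theorem path_map {β : Type*} {p q : α → V} (g : β → α) {l : List β} {v w : V} :
    Path p q v (l.map g) w ↔ Path (p ∘ g) (q ∘ g) v l w := by
  induction l generalizing v with
  | nil => rfl
  | cons a l ih => simp only [List.map_cons, Path, ih]; rfl

theorem Path.congr {p q p' q' : α → V} {l : List α} {v w : V} (h : Path p q v l w)
    (hp : ∀ a ∈ l, p' a = p a) (hq : ∀ a ∈ l, q' a = q a) : Path p' q' v l w := by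
  induction l generalizing v with
  | nil => exact h
  | cons a l ih =>
    refine ⟨(hp a (by simp)).trans h.1, ?_⟩
    rw [hq a (by simp)]
    exact ih h.2 (fun b hb => hp b (by simp [hb])) fun b hb => hq b (by simp [hb])

theorem Path.filter {p q : α → V} (s : α → Bool) {l : List α} {v w : V} (h : Path p q v l w)
    (hs : ∀ a ∈ l, s a = false → q a = p a) : Path p q v (l.filter s) w := by
  induction l generalizing v with
  | nil => exact h
  | cons a l ih =>
    have h2 := ih h.2 fun b hb => hs b (by simp [hb])
    cases ha : s a with
    | true => rw [List.filter_cons_of_pos ha]; exact ⟨h.1, h2⟩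
    | false =>
      rw [List.filter_cons_of_neg (by simp [ha])]
      rwa [hs a (by simp) ha, h.1] at h2

/-- Reinserting a passage that does not alter colors: it receives the color that the strand carries
at that place. Distinctness of the passages makes the assignment `g` consistent. -/
theorem Path.exists_of_filter {p q : α → V} (s : α → Bool) {l : List α} (hl : l.Nodup) {v w : V}
    (h : Path p q v (l.filter s) w) :
    ∃ g : α → V, Path (fun a => if s a then p a else g a) (fun a => if s a then q a else g a)
      v l w := by
  classical
  induction l generalizing v with
  | nil => exact ⟨fun _ => v, h⟩
  | cons a l ih =>
    rw [List.nodup_cons] at hl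
    cases ha : s a with
    | true =>
      rw [List.filter_cons_of_pos ha] at h
      obtain ⟨g, hg⟩ := ih hl.2 h.2
      refine ⟨g, ?_, ?_⟩
      · simpa [ha] using h.1
      · simpa [ha] using hg
    | false =>
      rw [List.filter_cons_of_neg (by simp [ha])] at h
      obtain ⟨g, hg⟩ := ih hl.2 h
      refine ⟨Function.update g a v, ?_, ?_⟩
      · simp [ha]
      · simp only [ha, Function.update_self]
        refine Path.congr (by simpa using hg) ?_ ?_ <;>
        · intro b hb
          have : b ≠ a := fun h => hl.1 (h ▸ hb)
          simp [Function.update_of_ne this]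

theorem Path.unique_of_filter {p q p' q' : α → V} (s : α → Bool) {l : List α} {v w w' : V}
    (h : Path p q v l w) (h' : Path p' q' v l w')
    (hs : ∀ a ∈ l, s a = false → q a = p a) (hs' : ∀ a ∈ l, s a = false → q' a = p' a)
    (hq : ∀ a ∈ l, s a = true → q a = q' a) : ∀ a ∈ l, p a = p' a := by
  induction l generalizing v with
  | nil => simp
  | cons a l ih =>
    have hpa : p a = p' a := h.1.trans h'.1.symm
    have hqa : q a = q' a := by
      cases ha : s a with
      | true => exact hq a (by simp) ha
      | false => rw [hs a (by simp) ha, hs' a (by simp) ha, hpa]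
    have h2 := h'.2
    rw [← hqa] at h2
    have := ih h.2 h2 (fun b hb => hs b (by simp [hb])) (fun b hb => hs' b (by simp [hb]))
      (fun b hb => hq b (by simp [hb]))
    intro b hb
    rcases List.mem_cons.1 hb with rfl | hb
    · exact hpa
    · exact this b hb

/-- The color at the beginning of a word. -/
def start (p : α → V) : List α → V → V
  | [], v => v
  | a :: _, _ => p a

theorem Path.start_eq {p q : α → V} {l : List α} {v w : V} (h : Path p q v l w) :
    start p l w = v := by
  cases l with
  | nil => exact h.symm
  | cons a l => exact h.1

theorem Path.isRotated {p q : α → V} {l l' : List α} {v : V} (h : Path p q v l v)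
    (hl : l ~r l') : Path p q (start p l' v) l' (start p l' v) := by
  obtain ⟨n, rfl⟩ := hl
  induction n generalizing l v with
  | zero => rw [List.rotate_zero, h.start_eq]; exact h
  | succ n ih =>
    cases l with
    | nil => rw [List.rotate_nil]; exact h
    | cons a l =>
      rw [List.rotate_cons_succ]
      obtain ⟨rfl, h2⟩ := h
      have h3 : Path p q (q a) (l ++ [a]) (q a) := path_append.2 ⟨p a, h2, rfl, rfl⟩
      have h4 := ih h3
      have : ∀ l' : List α, l' ≠ [] → start p l' (q a) = start p l' (p a) := by
        intro l' hl'
        cases l' with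
        | nil => exact absurd rfl hl'
        | cons => rfl
      rwa [this _ (by simp)] at h4

/-- `Blocks Q l`: the first member of a pair in `Q` is followed in `l` by the second one, and
the second member is preceded by the first one unless it is the head of `l`. -/
def Blocks (Q : α → α → Prop) (l : List α) : Prop :=
  (∀ u x t, l = u ++ x :: t → ∀ y, Q x y → ∃ t', t = y :: t') ∧
    ∀ u x y t, l = u ++ x :: y :: t → ∀ z, Q z y → z = x

theorem Blocks.tail {Q : α → α → Prop} {a : α} {l : List α} (h : Blocks Q (a :: l)) :
    Blocks Q l :=
  ⟨fun u x t hl => h.1 (a :: u) x t (by rw [hl]; rfl),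
    fun u x y t hl => h.2 (a :: u) x y t (by rw [hl]; rfl)⟩

/-- A local move affects only the short arcs between the two passages of a block. If the colors
entering and leaving the blocks are kept and the new inner colors match, the strand remains
coherently colored. -/
theorem Path.change_blocks {Q : α → α → Prop} {p q p' q' : α → V} {l : List α} {v w : V}
    (h : Path p q v l w) (hQ : Blocks Q l)
    (hp : ∀ a ∈ l, (∀ b, ¬Q b a) → p' a = p a) (hq : ∀ a ∈ l, (∀ b, ¬Q a b) → q' a = q a)
    (hpq : ∀ a b, Q a b → q' a = p' b) : Path p' q' (start p' l w) l w := by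
  induction l generalizing v with
  | nil => rfl
  | cons x l ih =>
    refine ⟨rfl, ?_⟩
    have key := ih h.2 hQ.tail (fun a ha => hp a (by simp [ha])) (fun a ha => hq a (by simp [ha]))
    suffices q' x = start p' l w by rwa [this]
    cases l with
    | nil =>
      have : q' x = q x := hq x (by simp) fun b hb => by
        obtain ⟨t', ht⟩ := hQ.1 [] x [] rfl b hb
        simp at ht
      rw [this]
      exact h.2
    | cons y l =>
      change q' x = p' y
      by_cases hxy : Q x y
      · exact hpq x y hxy
      · have h1 : q' x = q x := hq x (by simp) fun b hb => by
          obtain ⟨t', ht⟩ := hQ.1 [] x (y :: l) rfl b hb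
          rw [List.cons.injEq] at ht
          exact hxy (ht.1 ▸ hb)
        have h2 : p' y = p y := hp y (by simp) fun b hb =>
          hxy (hQ.2 [] x y l rfl b hb ▸ hb)
        rw [h1, h2]
        exact h.2.1.symm

end Path

end GaussDiagram

/-! ### Colorings of diagrams and virtual crossings -/

namespace GaussDiagram

variable {k : ℕ} {V : Type*}

theorem mem_crossings {D : GaussDiagram k} {c : ℕ} :
    c ∈ D.crossings ↔ ∃ i b, (c, b) ∈ D.word i := by
  simp [crossings]

theorem exists_mem_word {D : GaussDiagram k} {c : ℕ} (hc : c ∈ D.crossings) (b : Bool) :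
    ∃ i, (c, b) ∈ D.word i := by
  obtain ⟨i, b', h⟩ := mem_crossings.1 hc
  by_cases hb : b' = b
  · exact ⟨i, hb ▸ h⟩
  · obtain ⟨j, hj⟩ := D.paired i c b' h
    have : (!b') = b := by cases b <;> cases b' <;> simp_all
    exact ⟨j, this ▸ hj⟩

theorem mem_crossings_of_mem {D : GaussDiagram k} {a : ℕ × Bool} {i : Fin k}
    (h : a ∈ D.word i) : a.1 ∈ D.crossings :=
  mem_crossings.2 ⟨i, a.2, h⟩

theorem eq_of_word_eq {D D' : GaussDiagram k} (hw : ∀ i, D.word i = D'.word i)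
    (hs : D.sgn = D'.sgn) : D = D' := by
  cases D
  cases D'
  have := funext hw
  simp_all

theorem iso_of_word_eq {D D' : GaussDiagram k} (hw : ∀ i, D.word i = D'.word i)
    (hs : ∀ c ∈ D.crossings, D'.sgn c = D.sgn c) : D.Iso D' := by
  refine ⟨1, 1, fun i => ?_, hs⟩
  have : (Prod.map (⇑(1 : Equiv.Perm ℕ)) id : ℕ × Bool → ℕ × Bool) = id := by ext a <;> rfl
  rw [this, List.map_id, Equiv.Perm.one_apply, hw]

theorem Iso.symm {D D' : GaussDiagram k} (h : D.Iso D') : D'.Iso D := by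
  obtain ⟨σ, f, hw, hs⟩ := h
  have hff : (Prod.map (f.symm) id : ℕ × Bool → ℕ × Bool) ∘ Prod.map f id = id := by
    ext a <;> simp
  have hw' : ∀ i, (D'.word (σ i)).map (Prod.map (f.symm) id) ~r D.word i := fun i => by
    have := (hw i).map (Prod.map (f.symm) id : ℕ × Bool → ℕ × Bool)
    rwa [List.map_map, hff, List.map_id] at this
  refine ⟨σ.symm, f.symm, fun j => ?_, fun c hc => ?_⟩
  · have := (hw' (σ.symm j)).symm
    rwa [Equiv.apply_symm_apply] at this
  · obtain ⟨j, b, hj⟩ := mem_crossings.1 hc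
    have h1 := hw' (σ.symm j)
    rw [Equiv.apply_symm_apply] at h1
    have h2 := h1.mem_iff.1 (List.mem_map_of_mem hj)
    simpa using (hs _ (mem_crossings_of_mem h2)).symm

theorem crossings_virtualize (D : GaussDiagram k) (S : Finset ℕ) :
    (D.virtualize S).crossings = D.crossings \ S := by
  ext c
  simp only [mem_crossings, virtualize, List.mem_filter, Finset.mem_sdiff]
  constructor
  · rintro ⟨i, b, h, h'⟩
    exact ⟨⟨i, b, h⟩, by simpa using h'⟩
  · rintro ⟨⟨i, b, h⟩, h'⟩
    exact ⟨i, b, h, by simpa using h'⟩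

theorem crossings_crossingChange (D : GaussDiagram k) (T : Finset ℕ) :
    (D.crossingChange T).crossings = D.crossings := by
  ext c
  simp only [mem_crossings, crossingChange, mem_map_flip]
  constructor
  · rintro ⟨i, b, h⟩
    by_cases hc : c ∈ T
    · exact ⟨i, !b, by simpa [flip, hc] using h⟩
    · exact ⟨i, b, by simpa [flip, hc] using h⟩
  · rintro ⟨i, b, h⟩
    by_cases hc : c ∈ T
    · exact ⟨i, !b, by simpa [flip, hc] using h⟩
    · exact ⟨i, b, by simpa [flip, hc] using h⟩

/-- `r` computes the colors after the passages from the colors before them. A coloring consists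
of the colors of the base points and of the colors before the passages. -/
structure IsColoring [Zero V] (D : GaussDiagram k) (r : (ℕ × Bool → V) → ℕ × Bool → V)
    (x : (Fin k → V) × (ℕ × Bool → V)) : Prop where
  path : ∀ i, Path x.2 (r x.2) (x.1 i) (D.word i) (x.1 i)
  zero : ∀ a, a.1 ∉ D.crossings → x.2 a = 0

/-- The number of colorings. -/
noncomputable def colorings [Zero V] (D : GaussDiagram k)
    (r : (ℕ × Bool → V) → ℕ × Bool → V) : ℕ :=
  Nat.card {x // D.IsColoring r x}

variable [Zero V]

/-- The normalization to 0 away from the crossings leaves only finitely many free values. -/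
instance [Finite V] (D : GaussDiagram k) (r : (ℕ × Bool → V) → ℕ × Bool → V) :
    Finite {x // D.IsColoring r x} := by
  refine Finite.of_injective
    (fun x => ((x.1.1, fun a => x.1.2 (a.1.1, a.2)) : (Fin k → V) × (D.crossings × Bool → V)))
    fun x y h => ?_
  simp only [Prod.mk.injEq] at h
  refine Subtype.ext (Prod.ext h.1 (funext fun a => ?_))
  by_cases ha : a.1 ∈ D.crossings
  · exact congrFun h.2 (⟨a.1, ha⟩, a.2)
  · rw [x.2.zero a ha, y.2.zero a ha]

/-- Counts are compared through a relation that is total on the left and injective, so invariance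
reduces to two inequalities and no inverse map has to be built. -/
theorem colorings_le [Finite V] {D D' : GaussDiagram k} {r r' : (ℕ × Bool → V) → ℕ × Bool → V}
    (R : (Fin k → V) × (ℕ × Bool → V) → (Fin k → V) × (ℕ × Bool → V) → Prop)
    (h : ∀ x, D.IsColoring r x → ∃ y, D'.IsColoring r' y ∧ R x y)
    (hR : ∀ x x' y, D.IsColoring r x → D.IsColoring r x' → R x y → R x' y → x = x') :
    D.colorings r ≤ D'.colorings r' := by
  choose F hF hRF using h
  refine Nat.card_le_card_of_injective
    (fun x : {x // D.IsColoring r x} => (⟨F x.1 x.2, hF x.1 x.2⟩ : {y // D'.IsColoring r' y}))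
    fun x x' hxx => Subtype.ext (hR _ _ _ x.2 x'.2 (hRF _ x.2) ?_)
  have := congrArg Subtype.val hxx
  simp only at this
  rw [this]
  exact hRF _ x'.2

theorem IsColoring.base_eq {D : GaussDiagram k} {r : (ℕ × Bool → V) → ℕ × Bool → V}
    {x : (Fin k → V) × (ℕ × Bool → V)} (h : D.IsColoring r x) (i : Fin k) :
    x.1 i = start x.2 (D.word i) (x.1 i) :=
  (h.path i).start_eq.symm

/-- Colorings in which the crossings in `S` are treated as virtual ones correspond to colorings of
the diagram without these crossings. -/
theorem colorings_virtualize [Finite V] (D : GaussDiagram k) (S : Finset ℕ)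
    {r r' : (ℕ × Bool → V) → ℕ × Bool → V} (hr : ∀ f a, a.1 ∈ S → r f a = f a)
    (hr' : ∀ f f' a, a.1 ∉ S → (∀ b : ℕ × Bool, b.1 ∉ S → f' b = f b) → r' f' a = r f a) :
    D.colorings r = (D.virtualize S).colorings r' := by
  have hmem : ∀ a : ℕ × Bool, decide (a.1 ∉ S) = false ↔ a.1 ∈ S := fun a => by simp
  have hmem' : ∀ a : ℕ × Bool, decide (a.1 ∉ S) = true ↔ a.1 ∉ S := fun a => by simp
  apply le_antisymm
  · refine colorings_le (fun x y => x.1 = y.1 ∧ ∀ a : ℕ × Bool, a.1 ∉ S → x.2 a = y.2 a)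
      (fun x hx => ⟨(x.1, fun a => if a.1 ∈ S then 0 else x.2 a), ⟨fun i => ?_, fun a ha => ?_⟩,
        rfl, fun a ha => by simp [ha]⟩) ?_
    · have h1 := (hx.path i).filter (fun a => decide (a.1 ∉ S))
        fun a _ ha => hr _ _ ((hmem a).1 ha)
      refine h1.congr (fun a ha => ?_) fun a ha => ?_
      · have : a.1 ∉ S := by simpa using List.of_mem_filter ha
        simp [this]
      · have : a.1 ∉ S := by simpa using List.of_mem_filter ha
        exact hr' _ _ _ this fun b hb => by simp [hb]
    · rw [crossings_virtualize, Finset.mem_sdiff, not_and_not_right] at ha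
      by_cases hs : a.1 ∈ S
      · simp [hs]
      · simp only [hs, if_false]
        exact hx.zero a fun h => hs (ha h)
    · rintro x x' y hx hx' ⟨h1, h2⟩ ⟨h1', h2'⟩
      have hb : x.1 = x'.1 := h1.trans h1'.symm
      have hoff : ∀ a : ℕ × Bool, a.1 ∉ S → x.2 a = x'.2 a :=
        fun a ha => (h2 a ha).trans (h2' a ha).symm
      refine Prod.ext hb (funext fun a => ?_)
      by_cases ha : a.1 ∈ D.crossings
      · obtain ⟨i, hi⟩ := exists_mem_word ha a.2
        have hp' := hx'.path i
        rw [← hb] at hp'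
        refine Path.unique_of_filter (fun a => decide (a.1 ∉ S)) (hx.path i) hp'
          (fun b _ hb => hr _ _ ((hmem b).1 hb)) (fun b _ hb => hr _ _ ((hmem b).1 hb))
          (fun b _ hb => ?_) a hi
        rw [← hr' x.2 x.2 b ((hmem' b).1 hb) fun _ _ => rfl]
        exact hr' _ _ _ ((hmem' b).1 hb) fun c hc => hoff c hc
      · rw [hx.zero a ha, hx'.zero a ha]
  · refine colorings_le (fun y x => y.1 = x.1 ∧ ∀ a : ℕ × Bool, a.1 ∉ S → y.2 a = x.2 a)
      (fun y hy => ?_) ?_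
    · choose g hg using fun i => (hy.path i).exists_of_filter _ (D.nodup i)
      classical
      -- An erased passage lies on exactly one component, so the colors `g i` found separately on
      -- the components glue.
      set f : ℕ × Bool → V := fun a => if a.1 ∈ S then
        (if h : ∃ i, a ∈ D.word i then g h.choose a else 0) else y.2 a with hf
      have hfS : ∀ b : ℕ × Bool, b.1 ∉ S → y.2 b = f b := fun b hb => by simp [hf, hb]
      refine ⟨(y.1, f), ⟨fun i => ?_, fun a ha => ?_⟩, rfl, hfS⟩
      · have hfg : ∀ a ∈ D.word i, a.1 ∈ S → f a = g i a := fun a ha hs => by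
          have h : ∃ i, a ∈ D.word i := ⟨i, ha⟩
          simp only [hf, hs, if_true, dif_pos h]
          rw [D.disjoint _ _ a h.choose_spec ha]
        refine (hg i).congr (fun a ha => ?_) fun a ha => ?_
        · by_cases hs : a.1 ∈ S
          · simp [hs, hfg a ha hs]
          · simp [hs, hfS]
        · by_cases hs : a.1 ∈ S
          · simp [hs, hfg a ha hs, hr]
          · simp only [hs, not_false_eq_true, decide_true, if_true]
            exact (hr' _ _ _ hs hfS).symm
      · by_cases hs : a.1 ∈ S
        · have : ¬∃ i, a ∈ D.word i := fun ⟨i, hi⟩ => ha (mem_crossings_of_mem hi)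
          simp [hf, hs, this]
        · change f a = 0
          rw [← hfS a hs]
          refine hy.zero a ?_
          rw [crossings_virtualize, Finset.mem_sdiff]
          exact fun h => ha h.1
    · rintro y y' x hy hy' ⟨h1, h2⟩ ⟨h1', h2'⟩
      refine Prod.ext (h1.trans h1'.symm) (funext fun a => ?_)
      by_cases hs : a.1 ∈ S
      · have : a.1 ∉ (D.virtualize S).crossings := by simp [crossings_virtualize, hs]
        rw [hy.zero a this, hy'.zero a this]
      · rw [h2 a hs, h2' a hs]

/-- Each circle carries one free color, stored at its base point; this is why colorings record base
point colors besides the colors at passages. -/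
theorem colorings_trivial (r : (ℕ × Bool → V) → ℕ × Bool → V) :
    (trivial k).colorings r = Nat.card V ^ k := by
  have hc : (trivial k).crossings = ∅ := by
    ext c
    simp [mem_crossings, trivial]
  have e : {x // (trivial k).IsColoring r x} ≃ (Fin k → V) :=
    { toFun := fun x => x.1.1
      invFun := fun v => ⟨(v, fun _ => 0), ⟨fun _ => rfl, fun _ _ => rfl⟩⟩
      left_inv := fun x => Subtype.ext (Prod.ext rfl
        (funext fun a => (x.2.zero a (by simp [hc])).symm))
      right_inv := fun _ => rfl }
  rw [colorings, Nat.card_congr e, Nat.card_fun, Nat.card_fin]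

end GaussDiagram

/-! ### Base points and consecutive passages -/

namespace GaussDiagram

variable {k : ℕ} {V : Type*}

/-- The diagram with the words replaced by cyclic rotations. -/
def reword (D : GaussDiagram k) (w : Fin k → List (ℕ × Bool)) (hw : ∀ i, w i ~r D.word i) :
    GaussDiagram k where
  word := w
  sgn := D.sgn
  nodup i := (hw i).nodup_iff.2 (D.nodup i)
  disjoint i j a hi hj := D.disjoint i j a ((hw i).mem_iff.1 hi) ((hw j).mem_iff.1 hj)
  paired i c b h := by
    obtain ⟨j, hj⟩ := D.paired i c b ((hw i).mem_iff.1 h)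
    exact ⟨j, (hw j).mem_iff.2 hj⟩

theorem iso_of_isRotated {D D' : GaussDiagram k} (hw : ∀ i, D'.word i ~r D.word i)
    (hs : D'.sgn = D.sgn) : D.Iso D' := by
  refine ⟨1, 1, fun i => ?_, fun c _ => by rw [hs]; rfl⟩
  have : (Prod.map (⇑(1 : Equiv.Perm ℕ)) id : ℕ × Bool → ℕ × Bool) = id := by ext a <;> rfl
  rw [this, List.map_id, Equiv.Perm.one_apply]
  exact hw i

theorem isRotated_filter {α : Type*} {l l' : List α} (h : l ~r l') (s : α → Bool) :
    l.filter s ~r l'.filter s := by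
  obtain ⟨n, rfl⟩ := h
  rw [← List.rotate_mod, List.rotate_eq_drop_append_take_mod, List.filter_append]
  conv_lhs => rw [← List.take_append_drop (n % l.length) l, List.filter_append]
  rw [Nat.mod_mod]
  exact List.isRotated_append

/-- On some component, when read from its base point, the passage `a` is immediately followed by
the passage `b`. -/
def Block (D : GaussDiagram k) (a b : ℕ × Bool) : Prop :=
  ∃ i u t, D.word i = u ++ a :: b :: t

theorem isRotated_cons_cons {α : Type*} {l t : List α} {a b : α} (h : l ~r a :: b :: t) :
    (∃ u v, l = u ++ a :: b :: v) ∨ ∃ v, l = b :: (v ++ [a]) := by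
  obtain ⟨n, hn⟩ := h.symm
  rw [← List.rotate_mod, List.rotate_eq_drop_append_take_mod] at hn
  generalize n % (a :: b :: t).length % (a :: b :: t).length = m at hn
  rcases m with _ | _ | m
  · exact Or.inl ⟨[], t, by simpa using hn.symm⟩
  · exact Or.inr ⟨t, by simpa using hn.symm⟩
  · exact Or.inl ⟨t.drop m, t.take m, by simpa using hn.symm⟩

/-- By `hQ` the pairs never chain. If the base point separates one pair, moving it past a single
passage reunites that pair and cannot separate another one. -/
theorem exists_isRotated_blocks {α : Type*} (Q : α → α → Prop)
    (hQ : ∀ a b c d, Q a b → Q c d → c ≠ b) (l : List α) :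
    ∃ l', l' ~r l ∧ ∀ a b t, Q a b → l ~r a :: b :: t → ∃ u v, l' = u ++ a :: b :: v := by
  by_cases h : ∃ a b v, Q a b ∧ l = b :: (v ++ [a])
  · obtain ⟨a, b, v, hab, rfl⟩ := h
    refine ⟨v ++ [a, b], ?_, fun c d t hcd hl => ?_⟩
    · have := List.isRotated_concat b (v ++ [a])
      simpa using this
    · rcases isRotated_cons_cons hl with ⟨u, w, hu⟩ | ⟨w, hw⟩
      · cases u with
        | nil => exact absurd (List.cons.inj hu).1.symm (hQ _ _ _ _ hab hcd)
        | cons e u =>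
          refine ⟨u, w ++ [b], ?_⟩
          have := (List.cons.inj hu).2
          calc v ++ [a, b] = (v ++ [a]) ++ [b] := by simp
            _ = _ := by rw [this]; simp
      · obtain ⟨h1, h2⟩ := List.cons.inj hw
        obtain ⟨-, h3⟩ := List.append_inj' h2 rfl
        rw [← h1, ← (List.cons.inj h3).1]
        exact ⟨v, [], rfl⟩
  · refine ⟨l, List.IsRotated.refl _, fun a b t hab hl => ?_⟩
    rcases isRotated_cons_cons hl with h' | ⟨v, hv⟩
    · exact h'
    · exact absurd ⟨a, b, v, hab, hv⟩ h

theorem exists_reword (D : GaussDiagram k) (Q : ℕ × Bool → ℕ × Bool → Prop)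
    (hQ : ∀ a b c d, Q a b → Q c d → c ≠ b) (hD : ∀ a b, Q a b → D.Adj a b) :
    ∃ w, ∃ hw : ∀ i, w i ~r D.word i, ∀ a b, Q a b → (D.reword w hw).Block a b := by
  choose w hw hb using fun i => exists_isRotated_blocks Q hQ (D.word i)
  refine ⟨w, hw, fun a b hab => ?_⟩
  obtain ⟨i, t, ht⟩ := hD a b hab
  exact ⟨i, hb i a b t hab ht⟩

theorem append_cons_inj_of_nodup {α : Type*} {u u' t t' : List α} {x : α}
    (h : u ++ x :: t = u' ++ x :: t') (hn : (u ++ x :: t).Nodup) : u = u' ∧ t = t' := by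
  induction u generalizing u' with
  | nil =>
    cases u' with
    | nil => simpa using h
    | cons y u' =>
      simp only [List.nil_append, List.cons_append, List.cons.injEq] at h
      simp [h.2] at hn
  | cons y u ih =>
    cases u' with
    | nil =>
      simp only [List.nil_append, List.cons_append, List.cons.injEq] at h
      simp [h.1] at hn
    | cons z u' =>
      simp only [List.cons_append, List.cons.injEq] at h
      rw [List.cons_append, List.nodup_cons] at hn
      obtain ⟨h1, h2⟩ := ih h.2 hn.2
      exact ⟨by rw [h.1, h1], h2⟩

theorem blocks_word {D : GaussDiagram k} {Q : ℕ × Bool → ℕ × Bool → Prop}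
    (hQ : ∀ a b, Q a b → D.Block a b) (i : Fin k) : Blocks Q (D.word i) := by
  refine ⟨fun u x t h y hxy => ?_, fun u x y t h z hzy => ?_⟩
  · obtain ⟨j, u', t', h'⟩ := hQ _ _ hxy
    obtain rfl := D.disjoint i j x (by simp [h]) (by simp [h'])
    exact ⟨t', (append_cons_inj_of_nodup (h.symm.trans h') (h ▸ D.nodup i)).2⟩
  · obtain ⟨j, u', t', h'⟩ := hQ _ _ hzy
    obtain rfl := D.disjoint i j y (by simp [h]) (by simp [h'])
    have h1 : D.word i = (u ++ [x]) ++ y :: t := by simp [h]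
    have h2 : D.word i = (u' ++ [z]) ++ y :: t' := by simp [h']
    have := (append_cons_inj_of_nodup (h1.symm.trans h2) (h1 ▸ D.nodup i)).1
    simpa using (List.append_inj' this rfl).2.symm

theorem IsColoring.eq_of_block [Zero V] {D : GaussDiagram k}
    {r : (ℕ × Bool → V) → ℕ × Bool → V} {x : (Fin k → V) × (ℕ × Bool → V)}
    (h : D.IsColoring r x) {a b : ℕ × Bool} (hab : D.Block a b) : r x.2 a = x.2 b := by
  obtain ⟨i, u, t, hi⟩ := hab
  have := h.path i
  rw [hi, path_append] at this
  obtain ⟨v, -, -, h2, -⟩ := this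
  exact h2.symm

/-- Comparison of colorings of two diagrams that differ only in pairs of consecutive passages. -/
theorem colorings_le_of_blocks [Zero V] [Finite V] {D D' : GaussDiagram k}
    {r r' : (ℕ × Bool → V) → ℕ × Bool → V} (g : ℕ × Bool → ℕ × Bool) (T : Finset ℕ)
    (Q : ℕ × Bool → ℕ × Bool → Prop) (hw : ∀ i, D'.word i = (D.word i).map g)
    (hc : D'.crossings = D.crossings) (hQ : ∀ a b, Q a b → D.Block a b)
    (hQT : ∀ a : ℕ × Bool, a.1 ∈ T → (∃ b, Q a b) ∨ ∃ b, Q b a)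
    (hg : ∀ a : ℕ × Bool, a.1 ∉ T → g a = a)
    (hr : ∀ f f' a, a.1 ∉ T → (∀ b : ℕ × Bool, b.1 ∉ T → f' b = f b) → r' f' a = r f a)
    (h_ex : ∀ f, (∀ a b, Q a b → r f a = f b) → ∃ f', (∀ a : ℕ × Bool, a.1 ∉ T → f' a = f a) ∧
      ∀ a b, Q a b → f' (g a) = f a ∧ r' f' (g b) = r f b ∧ r' f' (g a) = f' (g b))
    (h_un : ∀ f f', (∀ a b, Q a b → r f a = f b) → (∀ a b, Q a b → r f' a = f' b) →
      (∀ a : ℕ × Bool, a.1 ∉ T → f a = f' a) → (∀ a b, Q a b → f a = f' a ∧ r f b = r f' b) →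
      ∀ a b, Q a b → f b = f' b) :
    D.colorings r ≤ D'.colorings r' := by
  refine colorings_le (fun x y => x.1 = y.1 ∧ (∀ a : ℕ × Bool, a.1 ∉ T → y.2 a = x.2 a) ∧
    ∀ a b, Q a b → y.2 (g a) = x.2 a ∧ r' y.2 (g b) = r x.2 b) (fun x hx => ?_) ?_
  -- The colors outside `T` and those entering and leaving each block are transported by `g`; only
  -- the color between the two passages of a block is chosen anew.
  · obtain ⟨f', hf1, hf2⟩ := h_ex x.2 fun a b hab => hx.eq_of_block (hQ a b hab)
    have hp : ∀ a : ℕ × Bool, (∀ b, ¬Q b a) → f' (g a) = x.2 a := fun a ha => by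
      by_cases hT : a.1 ∈ T
      · rcases hQT a hT with ⟨b, hb⟩ | ⟨b, hb⟩
        · exact (hf2 a b hb).1
        · exact absurd hb (ha b)
      · rw [hg a hT, hf1 a hT]
    have hq : ∀ a : ℕ × Bool, (∀ b, ¬Q a b) → r' f' (g a) = r x.2 a := fun a ha => by
      by_cases hT : a.1 ∈ T
      · rcases hQT a hT with ⟨b, hb⟩ | ⟨b, hb⟩
        · exact absurd hb (ha b)
        · exact (hf2 b a hb).2.1
      · rw [hg a hT]
        exact hr _ _ _ hT hf1
    refine ⟨(x.1, f'), ⟨fun i => ?_, fun a ha => ?_⟩, rfl, hf1,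
      fun a b hab => ⟨(hf2 a b hab).1, (hf2 a b hab).2.1⟩⟩
    · rw [hw, path_map]
      have := (hx.path i).change_blocks (p' := f' ∘ g) (q' := r' f' ∘ g) (blocks_word hQ i)
        (fun a _ ha => hp a ha) (fun a _ ha => hq a ha) fun a b hab => (hf2 a b hab).2.2
      convert this using 1
      cases hl : D.word i with
      | nil => rfl
      | cons a l =>
        -- The head of a word cannot be the second passage of a block, so its incoming color, which
        -- is the base point color, is unchanged.
        have h1 : f' (g a) = x.2 a := hp a fun b hb => by
          obtain ⟨j, u, t, hj⟩ := hQ b a hb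
          obtain rfl := D.disjoint i j a (by simp [hl]) (by simp [hj])
          have h2 : ([] : List (ℕ × Bool)) ++ a :: l = (u ++ [b]) ++ a :: t := by
            rw [List.nil_append, ← hl, hj]; simp
          have := (append_cons_inj_of_nodup h2 (by
            rw [List.nil_append, ← hl]; exact D.nodup i)).1
          simp at this
        have h3 := hx.path i
        rw [hl] at h3
        exact (h1.trans h3.1).symm
    · rw [hc] at ha
      have : a.1 ∉ T := fun hT => by
        have hblock : ∀ a b, Q a b → a.1 ∈ D.crossings ∧ b.1 ∈ D.crossings := fun a b hab => by
          obtain ⟨j, u, t, hj⟩ := hQ a b hab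
          exact ⟨mem_crossings_of_mem (i := j) (by simp [hj]),
            mem_crossings_of_mem (i := j) (by simp [hj])⟩
        rcases hQT a hT with ⟨b, hb⟩ | ⟨b, hb⟩
        · exact ha (hblock _ _ hb).1
        · exact ha (hblock _ _ hb).2
      exact (hf1 a this).trans (hx.zero a ha)
  · rintro x x' y hx hx' ⟨h1, h2, h3⟩ ⟨h1', h2', h3'⟩
    have hf : ∀ a b, Q a b → x.2 a = x'.2 a := fun a b hab =>
      (h3 a b hab).1.symm.trans (h3' a b hab).1
    have hT : ∀ a : ℕ × Bool, a.1 ∉ T → x.2 a = x'.2 a := fun a ha =>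
      (h2 a ha).symm.trans (h2' a ha)
    have hs := h_un x.2 x'.2 (fun a b hab => hx.eq_of_block (hQ a b hab))
      (fun a b hab => hx'.eq_of_block (hQ a b hab)) hT
      fun a b hab => ⟨hf a b hab, (h3 a b hab).2.symm.trans (h3' a b hab).2⟩
    refine Prod.ext (h1.trans h1'.symm) (funext fun a => ?_)
    by_cases ha : a.1 ∈ T
    · rcases hQT a ha with ⟨b, hb⟩ | ⟨b, hb⟩
      · exact hf a b hb
      · exact hs b a hb
    · exact hT a ha

end GaussDiagram

/-! ### Switches and the first Reidemeister move -/

/-- `pick e a b` is `a` if `e = 1` and `b` if `e = -1`. -/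
def pick {α : Type*} (e : ℤˣ) (a b : α) : α := if e = 1 then a else b

@[simp] theorem pick_one {α : Type*} (a b : α) : pick 1 a b = a := rfl

@[simp] theorem pick_neg_one {α : Type*} (a b : α) : pick (-1) a b = b := rfl

/-- The colors `oi`, `oo` of the over-strand and `ui`, `uo` of the under-strand before and after a
crossing of sign `s` fit together. -/
def Fits {V : Type*} (out : ℤˣ → Bool → V → V → V) (s : ℤˣ) (oi oo ui uo : V) : Prop :=
  oo = out s true oi ui ∧ uo = out s false ui oi

/-- The colors `T₀ T₁ T₂`, `M₀ M₁ M₂` and `B₀ B₁ B₂` of the top, middle and bottom strands fit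
together at the three crossings of a triangle. -/
def Triangle {V : Type*} (out : ℤˣ → Bool → V → V → V) (eT eM eB sx sy sz : ℤˣ)
    (T₀ T₁ T₂ M₀ M₁ M₂ B₀ B₁ B₂ : V) : Prop :=
  Fits out sx (pick eT T₀ T₁) (pick eT T₁ T₂) (pick eM M₀ M₁) (pick eM M₁ M₂) ∧
    Fits out sy (pick eT T₁ T₀) (pick eT T₂ T₁) (pick eB B₀ B₁) (pick eB B₁ B₂) ∧
    Fits out sz (pick eM M₁ M₀) (pick eM M₂ M₁) (pick eB B₁ B₀) (pick eB B₂ B₁)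

/-- A rule for the colors of the strands of a virtual link diagram that is compatible with the
Reidemeister moves: `out s b x y` is the color of a strand after a crossing of sign `s`, if the
strand had the color `x` and the other strand had the color `y` before the crossing; `b` tells
whether the strand passes over. -/
structure Switch (V : Type*) [AddCommGroup V] where
  out : ℤˣ → Bool → V → V → V
  out_sub : ∀ s b x y x' y', out s b (x - x') (y - y') = out s b x y - out s b x' y'
  r1 : ∀ s b x, ∃ m, ∀ y, y = out s b x y ↔ y = m
  r1_out : ∀ s b x y, y = out s b x y → out s (!b) y x = x
  r2 : ∀ s b x y, out (-s) b (out s b x y) (out s (!b) y x) = x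
  r2' : ∀ s x y, ∃ m n, ∀ x' y', x' = out s true x y' ∧ y' = out (-s) false y x' ↔
    x' = m ∧ y' = n
  r2'_out : ∀ s x y x' y', x' = out s true x y' → y' = out (-s) false y x' →
    out s false y' x = y ∧ out (-s) true x' y = x
  opposite : ∀ s e e' oi oo ui uo oi' oo' ui' uo', Fits out s oi oo ui uo →
    Fits out s oi' oo' ui' uo' → pick e oi oo = pick e oi' oo' → pick e' ui uo = pick e' ui' uo' →
      pick e oo oi = pick e oo' oi' ∧ pick e' uo ui = pick e' uo' ui'
  r3 : ∀ eT eM eB sx sy sz, sx * eM = sy * eB → sz * eM = sy * eT →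
    ∀ T₀ T₁ T₂ M₀ M₁ M₂ B₀ B₁ B₂,
      Triangle out eT eM eB sx sy sz T₀ T₁ T₂ M₀ M₁ M₂ B₀ B₁ B₂ → ∃ T M B,
        Triangle out (-eT) (-eM) (-eB) sx sy sz T₀ T T₂ M₀ M M₂ B₀ B B₂

namespace Switch

variable {V : Type*} [AddCommGroup V]

/-- Sideways invertibility: by `opposite`, the two outer colors at a vertex of the triangle
determine the two inner ones. The vertex `x` yields the inner top and middle colors, the vertex `y`
the inner bottom color. -/
theorem triangle_unique (A : Switch V) {eT eM eB sx sy sz : ℤˣ}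
    {T₀ T₁ T₂ M₀ M₁ M₂ B₀ B₁ B₂ T M B : V}
    (h : Triangle A.out eT eM eB sx sy sz T₀ T₁ T₂ M₀ M₁ M₂ B₀ B₁ B₂)
    (h' : Triangle A.out eT eM eB sx sy sz T₀ T T₂ M₀ M M₂ B₀ B B₂) :
    T₁ = T ∧ M₁ = M ∧ B₁ = B := by
  have hx := A.opposite sx eT eM _ _ _ _ _ _ _ _ h.1 h'.1
  have hy := A.opposite sy (-eT) eB _ _ _ _ _ _ _ _ h.2.1 h'.2.1
  rcases Int.units_eq_one_or eT with rfl | rfl <;> rcases Int.units_eq_one_or eM with rfl | rfl <;>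
    rcases Int.units_eq_one_or eB with rfl | rfl <;>
    simp only [pick_one, pick_neg_one, neg_neg, true_implies] at hx hy <;>
    exact ⟨hx.1, hx.2, hy.2⟩

/-- The colors after the passages. -/
def rule (A : Switch V) (s : ℕ → ℤˣ) (f : ℕ × Bool → V) (a : ℕ × Bool) : V :=
  A.out (s a.1) a.2 (f a) (f (a.1, !a.2))

/-- The colors after the passages if the crossings in `S` are considered as virtual ones. -/
def ruleOff (A : Switch V) (S : Finset ℕ) (s : ℕ → ℤˣ) (f : ℕ × Bool → V) (a : ℕ × Bool) : V :=
  if a.1 ∈ S then f a else A.rule s f a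

theorem ruleOff_of_mem (A : Switch V) {S : Finset ℕ} {s : ℕ → ℤˣ} {f : ℕ × Bool → V}
    {a : ℕ × Bool} (h : a.1 ∈ S) : A.ruleOff S s f a = f a := if_pos h

theorem ruleOff_of_notMem (A : Switch V) {S : Finset ℕ} {s : ℕ → ℤˣ} {f : ℕ × Bool → V}
    {a : ℕ × Bool} (h : a.1 ∉ S) : A.ruleOff S s f a = A.rule s f a := if_neg h

theorem rule_congr (A : Switch V) {S : Finset ℕ} {s : ℕ → ℤˣ} {f f' : ℕ × Bool → V}
    {a : ℕ × Bool} (h : a.1 ∉ S) (hf : ∀ b : ℕ × Bool, b.1 ∉ S → f' b = f b) :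
    A.rule s f' a = A.rule s f a := by
  rw [rule, rule, hf a h, hf _ (by exact h)]

open GaussDiagram

variable {k : ℕ}

/-- The number of colorings of a diagram. -/
noncomputable def count (A : Switch V) (D : GaussDiagram k) : ℕ := D.colorings (A.rule D.sgn)

variable [Finite V]

theorem count_virtualize (A : Switch V) (D : GaussDiagram k) (S : Finset ℕ) :
    A.count (D.virtualize S) = D.colorings (A.ruleOff S D.sgn) := by
  refine (colorings_virtualize D S (fun f a ha => A.ruleOff_of_mem ha)
    fun f f' a ha hf => ?_).symm
  rw [A.ruleOff_of_notMem ha]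
  exact A.rule_congr ha hf

theorem count_le_of_iso (A : Switch V) {D D' : GaussDiagram k} (h : D.Iso D') :
    A.count D ≤ A.count D' := by
  have hsymm := h.symm
  obtain ⟨σ, f, hw, hs⟩ := h
  refine colorings_le (fun x y => x.2 = y.2 ∘ Prod.map f id ∧
    ∀ i, y.1 (σ i) = start y.2 (D'.word (σ i)) (x.1 i)) (fun x hx => ?_) ?_
  · set p : ℕ × Bool → V := x.2 ∘ Prod.map f.symm id with hp
    have hxp : x.2 = p ∘ Prod.map f id := by ext ⟨a, b⟩; simp [hp]
    -- Rotation moves the base point, so its new color is read off at the head of the new word; a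
    -- component without crossings keeps its old color, the default value of `start`.
    refine ⟨(fun j => start p (D'.word j) (x.1 (σ.symm j)), p), ⟨fun j => ?_, fun a ha => ?_⟩,
      hxp, fun i => by simp⟩
    · obtain ⟨i, rfl⟩ := σ.surjective j
      simp only [Equiv.symm_apply_apply]
      refine Path.isRotated (l := (D.word i).map (Prod.map f id)) ?_ (hw i).symm
      rw [path_map]
      refine (hx.path i).congr (fun a _ => congrFun hxp.symm a) fun a ha => ?_
      simp only [rule, Function.comp_apply, Prod.map_fst, Prod.map_snd, id]
      rw [hs _ (mem_crossings_of_mem ha), hxp]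
      rfl
    · refine hx.zero _ fun hc => ha ?_
      obtain ⟨i, b, hi⟩ := mem_crossings.1 hc
      have := (hw i).mem_iff.2 (List.mem_map_of_mem hi)
      simpa using mem_crossings_of_mem this
  · rintro x x' y hx hx' ⟨h1, h2⟩ ⟨h1', h2'⟩
    have h12 := h1.trans h1'.symm
    refine Prod.ext (funext fun i => ?_) h12
    have e1 := h2 i
    have e2 := h2' i
    have e3 := hx.base_eq i
    have e4 := hx'.base_eq i
    have e5 := (hw i).perm.length_eq
    rw [List.length_map] at e5
    rcases hl : D.word i with _ | ⟨a, l⟩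
    · rw [hl, List.length_nil, List.length_eq_zero_iff] at e5
      rw [e5] at e1 e2
      exact e1.symm.trans e2
    · rw [hl] at e3 e4
      rw [e3, e4, h12]
      rfl

theorem count_eq_of_iso (A : Switch V) {D D' : GaussDiagram k} (h : D.Iso D') :
    A.count D = A.count D' :=
  (A.count_le_of_iso h).antisymm (A.count_le_of_iso h.symm)

/-- By `count_virtualize` both sides count colorings of the same diagram, with `c` virtual or
active. An active kink has exactly one admissible loop color (`Switch.r1`) and returns the incoming
color (`r1_out`), just as a virtual crossing does. -/
theorem count_r1 (A : Switch V) (D : GaussDiagram k) (c : ℕ) (b : Bool)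
    (h : D.Block (c, b) (c, !b)) : A.count (D.virtualize {c}) = A.count D := by
  rw [count_virtualize]
  set Q : ℕ × Bool → ℕ × Bool → Prop := fun x y => x = (c, b) ∧ y = (c, !b) with hQdef
  have hbb : (c, !b) ≠ (c, b) := by simp
  have hQ : ∀ x y, Q x y → D.Block x y := by rintro x y ⟨rfl, rfl⟩; exact h
  have hQT : ∀ x : ℕ × Bool, x.1 ∈ ({c} : Finset ℕ) → (∃ y, Q x y) ∨ ∃ y, Q y x := by
    rintro ⟨x, b'⟩ hx
    obtain rfl := Finset.mem_singleton.1 hx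
    by_cases hb : b' = b
    · exact Or.inl ⟨_, by rw [hb], rfl⟩
    · exact Or.inr ⟨_, rfl, by cases b <;> cases b' <;> simp_all⟩
  have hmem : ∀ b', ((c, b') : ℕ × Bool).1 ∈ ({c} : Finset ℕ) := fun b' =>
    Finset.mem_singleton_self c
  apply le_antisymm
  · refine colorings_le_of_blocks id {c} Q (fun i => by simp) rfl hQ hQT (fun _ _ => rfl)
      (fun f f' a ha hf => ?_) (fun f hf => ?_) ?_
    · rw [A.ruleOff_of_notMem ha]
      exact A.rule_congr ha hf
    · obtain ⟨m, hm⟩ := A.r1 (D.sgn c) b (f (c, b))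
      have hf1 := hf _ _ ⟨rfl, rfl⟩
      rw [A.ruleOff_of_mem (hmem _)] at hf1
      have hm' := (hm m).2 rfl
      refine ⟨Function.update f (c, !b) m, fun a ha => ?_, ?_⟩
      · rw [Function.update_of_ne]
        rintro rfl
        exact ha (hmem _)
      · rintro x y ⟨rfl, rfl⟩
        rw [A.ruleOff_of_mem (hmem _), ← hf1]
        simp only [id, rule, Function.update_self, Function.update_of_ne hbb.symm, Bool.not_not]
        exact ⟨trivial, A.r1_out _ _ _ _ hm', hm'.symm⟩
    · rintro f f' hf hf' - h x y ⟨rfl, rfl⟩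
      have h1 := hf _ _ ⟨rfl, rfl⟩
      have h2 := hf' _ _ ⟨rfl, rfl⟩
      have h3 := (h _ _ ⟨rfl, rfl⟩).1
      rw [A.ruleOff_of_mem (hmem _)] at h1 h2
      rw [← h1, ← h2, h3]
  · refine colorings_le_of_blocks id {c} Q (fun i => by simp) rfl hQ hQT (fun _ _ => rfl)
      (fun f f' a ha hf => ?_) (fun f hf => ?_) ?_
    · rw [A.ruleOff_of_notMem ha]
      exact A.rule_congr ha hf
    · have hf1 := hf _ _ ⟨rfl, rfl⟩
      refine ⟨Function.update f (c, !b) (f (c, b)), fun a ha => ?_, ?_⟩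
      · rw [Function.update_of_ne]
        rintro rfl
        exact ha (hmem _)
      · rintro x y ⟨rfl, rfl⟩
        simp only [id, A.ruleOff_of_mem (hmem _), Function.update_self,
          Function.update_of_ne hbb.symm, and_true, true_and]
        have := A.r1_out _ _ _ _ hf1.symm
        simp only [rule, Bool.not_not]
        exact this.symm
    · rintro f f' hf hf' - h x y ⟨rfl, rfl⟩
      have h1 := hf _ _ ⟨rfl, rfl⟩
      have h2 := hf' _ _ ⟨rfl, rfl⟩
      have h3 := (h _ _ ⟨rfl, rfl⟩).1
      obtain ⟨m, hm⟩ := A.r1 (D.sgn c) b (f (c, b))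
      simp only [rule] at h1 h2
      rw [← h3] at h2
      rw [(hm _).1 h1.symm, (hm _).1 h2.symm]

end Switch

/-! ### The second Reidemeister move -/

namespace Switch

open GaussDiagram

variable {V : Type*} [AddCommGroup V] [Finite V] {k : ℕ}

/-- Both strands meet `c` before `d`, so the inner colors are computed at `c`, and the crossing `d`
of opposite sign undoes the effect (`Switch.r2`). -/
theorem count_r2_parallel (A : Switch V) (D : GaussDiagram k) (c d : ℕ) (hcd : c ≠ d)
    (hs : D.sgn c = -D.sgn d) (ho : D.Block (c, true) (d, true))
    (hu : D.Block (c, false) (d, false)) : A.count (D.virtualize {c, d}) = A.count D := by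
  rw [count_virtualize]
  set Q : ℕ × Bool → ℕ × Bool → Prop := fun x y => ∃ b, x = (c, b) ∧ y = (d, b) with hQdef
  have hQ : ∀ x y, Q x y → D.Block x y := by
    rintro x y ⟨b, rfl, rfl⟩
    cases b <;> assumption
  have hQT : ∀ x : ℕ × Bool, x.1 ∈ ({c, d} : Finset ℕ) → (∃ y, Q x y) ∨ ∃ y, Q y x := by
    rintro ⟨x, b⟩ hx
    rcases Finset.mem_insert.1 hx with h | h
    · exact Or.inl ⟨(d, b), b, by simpa using h, rfl⟩
    · exact Or.inr ⟨(c, b), b, rfl, by simpa using h⟩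
  have hc : ∀ b, ((c, b) : ℕ × Bool).1 ∈ ({c, d} : Finset ℕ) := fun b => by simp
  have hd : ∀ b, ((d, b) : ℕ × Bool).1 ∈ ({c, d} : Finset ℕ) := fun b => by simp
  have hs' : D.sgn d = -D.sgn c := by rw [hs, neg_neg]
  apply le_antisymm
  · refine colorings_le_of_blocks id {c, d} Q (fun i => by simp) rfl hQ hQT (fun _ _ => rfl)
      (fun f f' a ha hf => ?_) (fun f hf => ?_) ?_
    · rw [A.ruleOff_of_notMem ha]
      exact A.rule_congr ha hf
    · refine ⟨fun a => if a.1 = d then A.rule D.sgn f (c, a.2) else f a, fun a ha => ?_, ?_⟩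
      · exact if_neg fun h => ha (by simp [h])
      · rintro x y ⟨b, rfl, rfl⟩
        have h1 := hf _ _ ⟨b, rfl, rfl⟩
        rw [A.ruleOff_of_mem (hc _)] at h1
        rw [A.ruleOff_of_mem (hd _), ← h1]
        simp only [id, rule, hcd, if_true, if_false, Bool.not_not, hs', A.r2, and_self]
    · rintro f f' hf hf' - h x y ⟨b, rfl, rfl⟩
      have h1 := hf _ _ ⟨b, rfl, rfl⟩
      have h2 := hf' _ _ ⟨b, rfl, rfl⟩
      rw [A.ruleOff_of_mem (hc _)] at h1 h2
      rw [← h1, ← h2, (h _ _ ⟨b, rfl, rfl⟩).1]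
  · refine colorings_le_of_blocks id {c, d} Q (fun i => by simp) rfl hQ hQT (fun _ _ => rfl)
      (fun f f' a ha hf => ?_) (fun f hf => ?_) ?_
    · rw [A.ruleOff_of_notMem ha]
      exact A.rule_congr ha hf
    · refine ⟨fun a => if a.1 = d then f (c, a.2) else f a, fun a ha => ?_, ?_⟩
      · exact if_neg fun h => ha (by simp [h])
      · rintro x y ⟨b, rfl, rfl⟩
        simp only [id, A.ruleOff_of_mem (hc _), A.ruleOff_of_mem (hd _), hcd, if_true, if_false,
          and_true, true_and]
        have h1 := hf _ _ ⟨b, rfl, rfl⟩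
        have h2 := hf _ _ ⟨!b, rfl, rfl⟩
        simp only [rule, Bool.not_not] at h1 h2 ⊢
        rw [← h1, ← h2, hs', A.r2]
    · rintro f f' hf hf' - h x y ⟨b, rfl, rfl⟩
      have h1 := hf _ _ ⟨b, rfl, rfl⟩
      have h2 := hf' _ _ ⟨b, rfl, rfl⟩
      rw [← h1, ← h2, rule, rule, (h _ _ ⟨b, rfl, rfl⟩).1, (h _ _ ⟨!b, rfl, rfl⟩).1]

/-- The inner colors of the two strands now depend on each other. `r2'` says that this implicit
system has exactly one solution, and `r2'_out` that the strands leave with the colors with which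
they entered. -/
theorem count_r2_antiparallel (A : Switch V) (D : GaussDiagram k) (c d : ℕ) (hcd : c ≠ d)
    (hs : D.sgn c = -D.sgn d) (ho : D.Block (c, true) (d, true))
    (hu : D.Block (d, false) (c, false)) : A.count (D.virtualize {c, d}) = A.count D := by
  rw [count_virtualize]
  set Q : ℕ × Bool → ℕ × Bool → Prop := fun x y =>
    (x = (c, true) ∧ y = (d, true)) ∨ (x = (d, false) ∧ y = (c, false)) with hQdef
  have hQ : ∀ x y, Q x y → D.Block x y := by
    rintro x y (⟨rfl, rfl⟩ | ⟨rfl, rfl⟩) <;> assumption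
  have hQo : Q (c, true) (d, true) := Or.inl ⟨rfl, rfl⟩
  have hQu : Q (d, false) (c, false) := Or.inr ⟨rfl, rfl⟩
  have hQT : ∀ x : ℕ × Bool, x.1 ∈ ({c, d} : Finset ℕ) → (∃ y, Q x y) ∨ ∃ y, Q y x := by
    rintro ⟨x, b⟩ hx
    rcases Finset.mem_insert.1 hx with h | h
    · obtain rfl : x = c := h
      cases b
      · exact Or.inr ⟨_, hQu⟩
      · exact Or.inl ⟨_, hQo⟩
    · obtain rfl : x = d := by simpa using h
      cases b
      · exact Or.inl ⟨_, hQu⟩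
      · exact Or.inr ⟨_, hQo⟩
  have hc : ∀ b, ((c, b) : ℕ × Bool).1 ∈ ({c, d} : Finset ℕ) := fun b => by simp
  have hd : ∀ b, ((d, b) : ℕ × Bool).1 ∈ ({c, d} : Finset ℕ) := fun b => by simp
  have hs' : D.sgn d = -D.sgn c := by rw [hs, neg_neg]
  have hoff : ∀ (f : ℕ × Bool → V) (m n : V) (a : ℕ × Bool), a.1 ∉ ({c, d} : Finset ℕ) →
      (if a = (d, true) then m else if a = (c, false) then n else f a) = f a := fun f m n a ha => by
    rw [if_neg, if_neg]
    · rintro rfl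
      exact ha (hc _)
    · rintro rfl
      exact ha (hd _)
  apply le_antisymm
  · refine colorings_le_of_blocks id {c, d} Q (fun i => by simp) rfl hQ hQT (fun _ _ => rfl)
      (fun f f' a ha hf => ?_) (fun f hf => ?_) ?_
    · rw [A.ruleOff_of_notMem ha]
      exact A.rule_congr ha hf
    · obtain ⟨m, n, hmn⟩ := A.r2' (D.sgn c) (f (c, true)) (f (d, false))
      obtain ⟨h1, h2⟩ := (hmn m n).2 ⟨rfl, rfl⟩
      obtain ⟨h3, h4⟩ := A.r2'_out _ _ _ _ _ h1 h2
      have e1 := hf _ _ hQo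
      have e2 := hf _ _ hQu
      rw [A.ruleOff_of_mem (hc _)] at e1
      rw [A.ruleOff_of_mem (hd _)] at e2
      refine ⟨fun a => if a = (d, true) then m else if a = (c, false) then n else f a,
        hoff f m n, ?_⟩
      rintro x y (⟨rfl, rfl⟩ | ⟨rfl, rfl⟩)
      · rw [A.ruleOff_of_mem (hd _), ← e1]
        simp [rule, hcd, hcd.symm, hs', h4, ← h1]
      · rw [A.ruleOff_of_mem (hc _), ← e2]
        simp [rule, hcd, hcd.symm, hs', h3, ← h2]
    · rintro f f' hf hf' - h x y hxy
      have h1 := hf _ _ hxy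
      have h2 := hf' _ _ hxy
      have h3 := (h _ _ hxy).1
      have : x.1 ∈ ({c, d} : Finset ℕ) := by
        rcases hxy with ⟨rfl, rfl⟩ | ⟨rfl, rfl⟩ <;> simp
      rw [A.ruleOff_of_mem this] at h1 h2
      rw [← h1, ← h2, h3]
  · refine colorings_le_of_blocks id {c, d} Q (fun i => by simp) rfl hQ hQT (fun _ _ => rfl)
      (fun f f' a ha hf => ?_) (fun f hf => ?_) ?_
    · rw [A.ruleOff_of_notMem ha]
      exact A.rule_congr ha hf
    · have e1 := hf _ _ hQo
      have e2 := hf _ _ hQu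
      simp only [rule, Bool.not_true, Bool.not_false, hs'] at e1 e2
      obtain ⟨h3, h4⟩ := A.r2'_out _ _ _ _ _ e1.symm e2.symm
      refine ⟨fun a => if a = (d, true) then f (c, true) else if a = (c, false) then f (d, false)
        else f a, hoff f _ _, ?_⟩
      rintro x y (⟨rfl, rfl⟩ | ⟨rfl, rfl⟩)
      · simp [rule, ruleOff, hcd, hs', h4]
      · simp [rule, ruleOff, hcd.symm, h3]
    · rintro f f' hf hf' - h
      obtain ⟨m, n, hmn⟩ := A.r2' (D.sgn c) (f (c, true)) (f (d, false))
      have e1 := hf _ _ hQo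
      have e2 := hf _ _ hQu
      have e1' := hf' _ _ hQo
      have e2' := hf' _ _ hQu
      simp only [rule, Bool.not_true, Bool.not_false, hs'] at e1 e2 e1' e2'
      rw [← (h _ _ hQo).1] at e1'
      rw [← (h _ _ hQu).1] at e2'
      have h1 := (hmn _ _).1 ⟨e1.symm, e2.symm⟩
      have h2 := (hmn _ _).1 ⟨e1'.symm, e2'.symm⟩
      rintro x y (⟨rfl, rfl⟩ | ⟨rfl, rfl⟩)
      · rw [h1.1, h2.1]
      · rw [h1.2, h2.2]

theorem count_r2 (A : Switch V) (D : GaussDiagram k) (c d : ℕ) (hcd : c ≠ d)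
    (hs : D.sgn c = -D.sgn d)
    (ho : D.Block (c, true) (d, true) ∨ D.Block (d, true) (c, true))
    (hu : D.Block (c, false) (d, false) ∨ D.Block (d, false) (c, false)) :
    A.count (D.virtualize {c, d}) = A.count D := by
  have hs' : D.sgn d = -D.sgn c := by rw [hs, neg_neg]
  rcases ho with ho | ho <;> rcases hu with hu | hu
  · exact A.count_r2_parallel D c d hcd hs ho hu
  · exact A.count_r2_antiparallel D c d hcd hs ho hu
  · rw [Finset.pair_comm]
    exact A.count_r2_antiparallel D d c hcd.symm hs' ho hu
  · rw [Finset.pair_comm]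
    exact A.count_r2_parallel D d c hcd.symm hs' ho hu

end Switch

/-! ### The third Reidemeister move -/

namespace Switch

open GaussDiagram

variable {V : Type*} [AddCommGroup V] [Finite V] {k : ℕ}

/-- The three permutations of a third Reidemeister move combined. -/
def r3Perm (x y z : ℕ) : Equiv.Perm (ℕ × Bool) :=
  Equiv.swap (x, true) (y, true) * Equiv.swap (x, false) (z, true) *
    Equiv.swap (y, false) (z, false)

section

variable {x y z : ℕ}

theorem r3Perm_apply (hxy : x ≠ y) (hxz : x ≠ z) (hyz : y ≠ z) :
    r3Perm x y z (x, true) = (y, true) ∧ r3Perm x y z (y, true) = (x, true) ∧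
      r3Perm x y z (x, false) = (z, true) ∧ r3Perm x y z (z, true) = (x, false) ∧
      r3Perm x y z (y, false) = (z, false) ∧ r3Perm x y z (z, false) = (y, false) := by
  simp [r3Perm, Equiv.swap_apply_def, hxy, hxz, hyz, hxy.symm, hxz.symm, hyz.symm]

theorem r3Perm_of_ne {a : ℕ × Bool} (h : a.1 ∉ ({x, y, z} : Finset ℕ)) :
    r3Perm x y z a = a := by
  simp only [Finset.mem_insert, Finset.mem_singleton, not_or] at h
  have h1 : ∀ b, a ≠ (x, b) := fun b hb => h.1 (by rw [hb])
  have h2 : ∀ b, a ≠ (y, b) := fun b hb => h.2.1 (by rw [hb])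
  have h3 : ∀ b, a ≠ (z, b) := fun b hb => h.2.2 (by rw [hb])
  simp [r3Perm, Equiv.swap_apply_of_ne_of_ne, h1, h2, h3]

theorem r3Perm_fst_mem (hxy : x ≠ y) (hxz : x ≠ z) (hyz : y ≠ z) {a : ℕ × Bool} :
    (r3Perm x y z a).1 ∈ ({x, y, z} : Finset ℕ) ↔ a.1 ∈ ({x, y, z} : Finset ℕ) := by
  obtain ⟨h1, h2, h3, h4, h5, h6⟩ := r3Perm_apply hxy hxz hyz
  by_cases h : a.1 ∈ ({x, y, z} : Finset ℕ)
  · refine iff_of_true ?_ h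
    obtain ⟨c, b⟩ := a
    simp only [Finset.mem_insert, Finset.mem_singleton] at h
    rcases h with rfl | rfl | rfl <;> cases b <;> simp [h1, h2, h3, h4, h5, h6]
  · rw [r3Perm_of_ne h]

end

/-- The axiom `r3` supplies inner colors for the new triangle with the same six outer ones;
`triangle_unique` makes the passage injective. One inequality suffices, because the inverse of a
third move is again a third move. -/
theorem count_r3_le (A : Switch V) (D D' : GaussDiagram k) (x y z : ℕ) (hxy : x ≠ y) (hxz : x ≠ z)
    (hyz : y ≠ z) (eT eM eB : ℤˣ)
    (hT : D.Block (pick eT (x, true) (y, true)) (pick eT (y, true) (x, true)))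
    (hM : D.Block (pick eM (x, false) (z, true)) (pick eM (z, true) (x, false)))
    (hB : D.Block (pick eB (y, false) (z, false)) (pick eB (z, false) (y, false)))
    (h₁ : D.sgn x * eM = D.sgn y * eB) (h₂ : D.sgn z * eM = D.sgn y * eT)
    (hw : ∀ i, D'.word i = (D.word i).map (r3Perm x y z)) (hs : D'.sgn = D.sgn) :
    A.count D ≤ A.count D' := by
  obtain ⟨p1, p2, p3, p4, p5, p6⟩ := r3Perm_apply hxy hxz hyz
  set g := r3Perm x y z with hg
  set T : Finset ℕ := {x, y, z} with hTdef
  set Q : ℕ × Bool → ℕ × Bool → Prop := fun a b =>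
    (a = pick eT (x, true) (y, true) ∧ b = pick eT (y, true) (x, true)) ∨
    (a = pick eM (x, false) (z, true) ∧ b = pick eM (z, true) (x, false)) ∨
    (a = pick eB (y, false) (z, false) ∧ b = pick eB (z, false) (y, false)) with hQdef
  have hQ : ∀ a b, Q a b → D.Block a b := by
    rintro a b (⟨rfl, rfl⟩ | ⟨rfl, rfl⟩ | ⟨rfl, rfl⟩) <;> assumption
  have hQT : ∀ a : ℕ × Bool, a.1 ∈ T → (∃ b, Q a b) ∨ ∃ b, Q b a := by
    have key : ∀ (e : ℤˣ) (a b : ℕ × Bool),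
        (∀ c d, c = pick e a b → d = pick e b a → Q c d) →
          ((∃ c, Q a c) ∨ ∃ c, Q c a) ∧ ((∃ c, Q b c) ∨ ∃ c, Q c b) := fun e a b h => by
      have := h _ _ rfl rfl
      rcases Int.units_eq_one_or e with rfl | rfl
      · exact ⟨Or.inl ⟨_, this⟩, Or.inr ⟨_, this⟩⟩
      · exact ⟨Or.inr ⟨_, this⟩, Or.inl ⟨_, this⟩⟩
    have k1 := key eT (x, true) (y, true) fun c d hc hd => Or.inl ⟨hc, hd⟩
    have k2 := key eM (x, false) (z, true) fun c d hc hd => Or.inr (Or.inl ⟨hc, hd⟩)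
    have k3 := key eB (y, false) (z, false) fun c d hc hd => Or.inr (Or.inr ⟨hc, hd⟩)
    rintro ⟨c, b⟩ h
    simp only [hTdef, Finset.mem_insert, Finset.mem_singleton] at h
    rcases h with rfl | rfl | rfl <;> cases b
    exacts [k2.1, k1.1, k3.1, k1.2, k3.2, k2.2]
  have hc : D'.crossings = D.crossings := by
    have hle : ∀ c, c ∈ T → c ∈ D.crossings := fun c hc => by
      rcases hQT (c, true) hc with ⟨b, hb⟩ | ⟨b, hb⟩
      · obtain ⟨i, u, t, h⟩ := hQ _ _ hb
        exact mem_crossings.2 ⟨i, true, by simp [h]⟩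
      · obtain ⟨i, u, t, h⟩ := hQ _ _ hb
        exact mem_crossings.2 ⟨i, true, by simp [h]⟩
    ext c
    by_cases hcT : c ∈ T
    · refine iff_of_true ?_ (hle c hcT)
      have h1 : (g.symm (c, true)).1 ∈ T := by
        rw [hTdef, ← r3Perm_fst_mem hxy hxz hyz, ← hg, Equiv.apply_symm_apply]
        exact hcT
      obtain ⟨i, hi⟩ := exists_mem_word (hle _ h1) (g.symm (c, true)).2
      refine mem_crossings.2 ⟨i, true, ?_⟩
      rw [hw]
      exact List.mem_map.2 ⟨_, hi, by simp⟩
    · simp only [mem_crossings, hw, List.mem_map]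
      constructor
      · rintro ⟨i, b, a, ha, hab⟩
        have : a.1 ∉ T := by
          rw [hTdef, ← r3Perm_fst_mem hxy hxz hyz, ← hg, hab]
          exact hcT
        rw [hg, r3Perm_of_ne this] at hab
        exact ⟨i, b, hab ▸ ha⟩
      · rintro ⟨i, b, h⟩
        exact ⟨i, b, (c, b), h, r3Perm_of_ne hcT⟩
  have htri : ∀ f : ℕ × Bool → V, (∀ a b, Q a b → A.rule D.sgn f a = f b) →
      Triangle A.out eT eM eB (D.sgn x) (D.sgn y) (D.sgn z)
        (f (pick eT (x, true) (y, true))) (f (pick eT (y, true) (x, true)))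
        (A.rule D.sgn f (pick eT (y, true) (x, true)))
        (f (pick eM (x, false) (z, true))) (f (pick eM (z, true) (x, false)))
        (A.rule D.sgn f (pick eM (z, true) (x, false)))
        (f (pick eB (y, false) (z, false))) (f (pick eB (z, false) (y, false)))
        (A.rule D.sgn f (pick eB (z, false) (y, false))) := fun f hf => by
    have e1 := hf _ _ (Or.inl ⟨rfl, rfl⟩)
    have e2 := hf _ _ (Or.inr (Or.inl ⟨rfl, rfl⟩))
    have e3 := hf _ _ (Or.inr (Or.inr ⟨rfl, rfl⟩))
    rcases Int.units_eq_one_or eT with rfl | rfl <;>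
      rcases Int.units_eq_one_or eM with rfl | rfl <;>
      rcases Int.units_eq_one_or eB with rfl | rfl <;>
      simp only [pick_one, pick_neg_one] at e1 e2 e3 ⊢ <;>
      rw [← e1, ← e2, ← e3] <;> simp only [Triangle, Fits, pick_one, pick_neg_one] <;>
      rw [e1, e2, e3] <;>
      simp only [rule, Bool.not_true, Bool.not_false] at e1 e2 e3 ⊢ <;>
      simp only [e1, e2, e3, and_self]
  refine colorings_le_of_blocks g T Q hw hc hQ hQT (fun a ha => r3Perm_of_ne ha)
    (fun f f' a ha hf => ?_) (fun f hf => ?_) ?_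
  · rw [hs]
    exact A.rule_congr ha hf
  · obtain ⟨t, m, b, h⟩ := A.r3 eT eM eB _ _ _ h₁ h₂ _ _ _ _ _ _ _ _ _ (htri f hf)
    refine ⟨fun a =>
      if a = (x, true) then pick eT t (f (y, true)) else
      if a = (y, true) then pick eT (f (x, true)) t else
      if a = (x, false) then pick eM m (f (z, true)) else
      if a = (z, true) then pick eM (f (x, false)) m else
      if a = (y, false) then pick eB b (f (z, false)) else
      if a = (z, false) then pick eB (f (y, false)) b else f a, fun a ha => ?_, ?_⟩
    · simp only [hTdef, Finset.mem_insert, Finset.mem_singleton, not_or] at ha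
      have h1 : ∀ b, a ≠ (x, b) := fun b hb => ha.1 (by rw [hb])
      have h2 : ∀ b, a ≠ (y, b) := fun b hb => ha.2.1 (by rw [hb])
      have h3 : ∀ b, a ≠ (z, b) := fun b hb => ha.2.2 (by rw [hb])
      simp [h1, h2, h3]
    · rw [hs]
      obtain ⟨⟨a1, a2⟩, ⟨a3, a4⟩, ⟨a5, a6⟩⟩ := h
      rcases Int.units_eq_one_or eT with rfl | rfl <;>
        rcases Int.units_eq_one_or eM with rfl | rfl <;>
        rcases Int.units_eq_one_or eB with rfl | rfl <;>
        simp only [pick_one, pick_neg_one, neg_neg] at a1 a2 a3 a4 a5 a6 <;>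
        rintro u v (⟨rfl, rfl⟩ | ⟨rfl, rfl⟩ | ⟨rfl, rfl⟩) <;>
        simp only [pick_one, pick_neg_one, p1, p2, p3, p4, p5, p6, rule, Bool.not_true,
          Bool.not_false, Prod.mk.injEq, hxy, hxz, hyz, hxy.symm, hxz.symm, hyz.symm, if_true,
          if_false, true_and, and_true, and_false, Bool.true_eq_false,
          Bool.false_eq_true] at a1 a2 a3 a4 a5 a6 ⊢ <;>
        simp only [← a1, ← a2, ← a3, ← a4, ← a5, ← a6, and_self]
  · rintro f f' hf hf' - h
    have t1 := htri f hf
    have t2 := htri f' hf'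
    have hi1 := h _ _ (Or.inl ⟨rfl, rfl⟩)
    have hi2 := h _ _ (Or.inr (Or.inl ⟨rfl, rfl⟩))
    have hi3 := h _ _ (Or.inr (Or.inr ⟨rfl, rfl⟩))
    rw [← hi1.1, ← hi1.2, ← hi2.1, ← hi2.2, ← hi3.1, ← hi3.2] at t2
    have := A.triangle_unique t1 t2
    rintro a b (⟨rfl, rfl⟩ | ⟨rfl, rfl⟩ | ⟨rfl, rfl⟩)
    exacts [this.1, this.2.1, this.2.2]

end Switch

/-! ### Invariance of the number of colorings -/

namespace Switch

open GaussDiagram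

variable {V : Type*} [AddCommGroup V] [Finite V] {k : ℕ}

theorem adjBy_iff {D : GaussDiagram k} {e : ℤˣ} {a b : ℕ × Bool} :
    D.AdjBy e a b ↔ D.Adj (pick e a b) (pick e b a) := by
  rcases Int.units_eq_one_or e with rfl | rfl <;> simp [AdjBy]

theorem reword_virtualize_iso (D : GaussDiagram k) (w : Fin k → List (ℕ × Bool))
    (hw : ∀ i, w i ~r D.word i) (S : Finset ℕ) :
    ((D.reword w hw).virtualize S).Iso (D.virtualize S) :=
  iso_of_isRotated (fun i => isRotated_filter (hw i).symm _) rfl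

theorem count_reword (A : Switch V) (D : GaussDiagram k) (w : Fin k → List (ℕ × Bool))
    (hw : ∀ i, w i ~r D.word i) : A.count (D.reword w hw) = A.count D :=
  A.count_eq_of_iso (iso_of_isRotated (fun i => (hw i).symm) rfl)

/-- Adjacency is cyclic, blocks are linear: base points are first moved so that none of them
separates one of the three pairs. -/
theorem count_le_of_r3 (A : Switch V) (D D' : GaussDiagram k) (x y z : ℕ) (hxy : x ≠ y)
    (hxz : x ≠ z) (hyz : y ≠ z) (eT eM eB : ℤˣ) (hT : D.AdjBy eT (x, true) (y, true))
    (hM : D.AdjBy eM (x, false) (z, true)) (hB : D.AdjBy eB (y, false) (z, false))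
    (h₁ : D.sgn x * eM = D.sgn y * eB) (h₂ : D.sgn z * eM = D.sgn y * eT)
    (hw : ∀ i, D'.word i = (D.word i).map (r3Perm x y z)) (hs : D'.sgn = D.sgn) :
    A.count D ≤ A.count D' := by
  rw [adjBy_iff] at hT hM hB
  obtain ⟨w, hw', hb⟩ := D.exists_reword (fun a b =>
    (a = pick eT (x, true) (y, true) ∧ b = pick eT (y, true) (x, true)) ∨
    (a = pick eM (x, false) (z, true) ∧ b = pick eM (z, true) (x, false)) ∨
    (a = pick eB (y, false) (z, false) ∧ b = pick eB (z, false) (y, false)))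
    (by
      rcases Int.units_eq_one_or eT with rfl | rfl <;>
        rcases Int.units_eq_one_or eM with rfl | rfl <;>
        rcases Int.units_eq_one_or eB with rfl | rfl <;>
        rintro a b c d (⟨rfl, rfl⟩ | ⟨rfl, rfl⟩ | ⟨rfl, rfl⟩)
          (⟨rfl, rfl⟩ | ⟨rfl, rfl⟩ | ⟨rfl, rfl⟩) <;>
        simp [hxy, hxz, hyz, hxy.symm, hxz.symm, hyz.symm])
    (by rintro a b (⟨rfl, rfl⟩ | ⟨rfl, rfl⟩ | ⟨rfl, rfl⟩) <;> assumption)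
  have hw2 : ∀ i, (w i).map (r3Perm x y z) ~r D'.word i := fun i => by
    rw [hw]
    exact (hw' i).map _
  rw [← A.count_reword D w hw', ← A.count_reword D' _ hw2]
  exact A.count_r3_le _ _ x y z hxy hxz hyz eT eM eB (hb _ _ (Or.inl ⟨rfl, rfl⟩))
    (hb _ _ (Or.inr (Or.inl ⟨rfl, rfl⟩))) (hb _ _ (Or.inr (Or.inr ⟨rfl, rfl⟩))) h₁ h₂
    (fun i => rfl) hs

theorem count_eq_of_move (A : Switch V) {D D' : GaussDiagram k} (h : Move D D') :
    A.count D = A.count D' := by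
  cases h with
  | iso _ h => exact A.count_eq_of_iso h
  | r1 c b h =>
    obtain ⟨w, hw, hb⟩ := D.exists_reword (fun x y => x = (c, b) ∧ y = (c, !b))
      (by rintro a b' c' d ⟨rfl, rfl⟩ ⟨rfl, rfl⟩; simp) (by rintro _ _ ⟨rfl, rfl⟩; exact h)
    rw [← A.count_reword D w hw, ← A.count_eq_of_iso (reword_virtualize_iso D w hw {c})]
    exact (A.count_r1 _ c b (hb _ _ ⟨rfl, rfl⟩)).symm
  | r2 c d hcd hs ho hu =>
    have ho' : ∃ e : ℤˣ, D.Adj (pick e (c, true) (d, true)) (pick e (d, true) (c, true)) := by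
      rcases ho with h | h
      exacts [⟨1, h⟩, ⟨-1, by simpa using h⟩]
    have hu' : ∃ e : ℤˣ, D.Adj (pick e (c, false) (d, false)) (pick e (d, false) (c, false)) := by
      rcases hu with h | h
      exacts [⟨1, h⟩, ⟨-1, by simpa using h⟩]
    obtain ⟨e, ho'⟩ := ho'
    obtain ⟨e', hu'⟩ := hu'
    obtain ⟨w, hw, hb⟩ := D.exists_reword (fun a b =>
      (a = pick e (c, true) (d, true) ∧ b = pick e (d, true) (c, true)) ∨
      (a = pick e' (c, false) (d, false) ∧ b = pick e' (d, false) (c, false)))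
      (by
        rcases Int.units_eq_one_or e with rfl | rfl <;>
          rcases Int.units_eq_one_or e' with rfl | rfl <;>
          rintro a b c' d' (⟨rfl, rfl⟩ | ⟨rfl, rfl⟩) (⟨rfl, rfl⟩ | ⟨rfl, rfl⟩) <;>
          simp [hcd, hcd.symm])
      (by rintro a b (⟨rfl, rfl⟩ | ⟨rfl, rfl⟩) <;> assumption)
    rw [← A.count_reword D w hw, ← A.count_eq_of_iso (reword_virtualize_iso D w hw {c, d})]
    refine (A.count_r2 (D.reword w hw) c d hcd hs ?_ ?_).symm
    · have := hb _ _ (Or.inl ⟨rfl, rfl⟩)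
      rcases Int.units_eq_one_or e with rfl | rfl
      exacts [Or.inl this, Or.inr this]
    · have := hb _ _ (Or.inr ⟨rfl, rfl⟩)
      rcases Int.units_eq_one_or e' with rfl | rfl
      exacts [Or.inl this, Or.inr this]
  | r3 _ x y z hxy hxz hyz eT eM eB hT hM hB h₁ h₂ hw hs =>
    apply le_antisymm
    · exact A.count_le_of_r3 D D' x y z hxy hxz hyz eT eM eB hT hM hB h₁ h₂ hw hs
    -- The reverse move uses the same involution on passages with all three orders negated; the sign
    -- equations survive because both sides change sign.
    · obtain ⟨p1, p2, p3, p4, p5, p6⟩ := r3Perm_apply hxy hxz hyz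
      have hadj : ∀ {e a b a' b'}, D.AdjBy e a b → r3Perm x y z a = a' → r3Perm x y z b = b' →
          D'.AdjBy (-e) b' a' := by
        rintro e a b a' b' h rfl rfl
        rw [adjBy_iff] at h ⊢
        obtain ⟨i, t, ht⟩ := h
        refine ⟨i, t.map (r3Perm x y z), ?_⟩
        rw [hw]
        have := ht.map (r3Perm x y z)
        rcases Int.units_eq_one_or e with rfl | rfl <;> exact this
      refine A.count_le_of_r3 D' D x y z hxy hxz hyz (-eT) (-eM) (-eB) (hadj hT p1 p2)
        (hadj hM p3 p4) (hadj hB p5 p6) (by rw [hs]; simp [h₁]) (by rw [hs]; simp [h₂])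
        (fun i => ?_) hs.symm
      have hwi : D'.word i = (D.word i).map (r3Perm x y z) := hw i
      rw [hwi, List.map_map]
      have : ⇑(r3Perm x y z) ∘ ⇑(r3Perm x y z) = id := by
        funext ⟨c, b⟩
        by_cases h : c ∈ ({x, y, z} : Finset ℕ)
        · simp only [Finset.mem_insert, Finset.mem_singleton] at h
          rcases h with rfl | rfl | rfl <;> cases b <;> simp [p1, p2, p3, p4, p5, p6]
        · simp [r3Perm_of_ne (a := (c, b)) h]
      rw [this, List.map_id]

theorem count_eq_of_equiv (A : Switch V) {D D' : GaussDiagram k} (h : D ≈ D') :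
    A.count D = A.count D' := by
  induction h with
  | rel _ _ h => exact A.count_eq_of_move h
  | refl => rfl
  | symm _ _ _ ih => exact ih.symm
  | trans _ _ _ _ _ ih ih' => exact ih.trans ih'

theorem count_of_equiv_trivial (A : Switch V) {D : GaussDiagram k}
    (h : D ≈ GaussDiagram.trivial k) : A.count D = Nat.card V ^ k := by
  rw [A.count_eq_of_equiv h, count, colorings_trivial]

end Switch

/-! ### Linearity and the cost of virtualizations and crossing changes -/

namespace GaussDiagram

theorem Path.sub {α V : Type*} [AddCommGroup V] {p q p' q' : α → V} {l : List α} {v w v' w' : V}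
    (h : Path p q v l w) (h' : Path p' q' v' l w') :
    Path (p - p') (q - q') (v - v') l (w - w') := by
  induction l generalizing v v' with
  | nil => exact congrArg₂ _ h h'
  | cons a l ih => exact ⟨congrArg₂ _ h.1 h'.1, ih h.2 h'.2⟩

end GaussDiagram

namespace Switch

open GaussDiagram

variable {V : Type*} [AddCommGroup V] {k : ℕ}

theorem rule_sub (A : Switch V) (s : ℕ → ℤˣ) (f f' : ℕ × Bool → V) :
    A.rule s (f - f') = A.rule s f - A.rule s f' :=
  funext fun _ => A.out_sub _ _ _ _ _ _

theorem isColoring_sub (A : Switch V) {D : GaussDiagram k}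
    {x y : (Fin k → V) × (ℕ × Bool → V)} (hx : D.IsColoring (A.rule D.sgn) x)
    (hy : D.IsColoring (A.rule D.sgn) y) : D.IsColoring (A.rule D.sgn) (x - y) where
  path i := by
    rw [Prod.snd_sub, A.rule_sub]
    exact (hx.path i).sub (hy.path i)
  zero a ha := by
    rw [Prod.snd_sub, Pi.sub_apply, hx.zero a ha, hy.zero a ha, sub_zero]

variable [Finite V]

/-- A linear condition with values in `W` on the colors at each crossing in `S` reduces the number
of colorings at most by the factor `|W| ^ |S|`. -/
theorem count_le_mul (A : Switch V) (D : GaussDiagram k) (S : Finset ℕ) {W : Type*}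
    [AddCommGroup W] [Finite W] (δ : V → V → W)
    (hδ : ∀ x y x' y', δ (x - x') (y - y') = δ x y - δ x' y')
    {r : (ℕ × Bool → V) → ℕ × Bool → V}
    (h : ∀ f : ℕ × Bool → V, (∀ c ∈ S, δ (f (c, true)) (f (c, false)) = 0) →
      r f = A.rule D.sgn f) :
    A.count D ≤ Nat.card W ^ S.card * D.colorings r := by
  rcases isEmpty_or_nonempty {x // D.IsColoring (A.rule D.sgn) x} with hE | hE
  · rw [count, colorings, Nat.card_of_isEmpty]
    exact Nat.zero_le _
  · set F : {x // D.IsColoring (A.rule D.sgn) x} → S → W := fun x c =>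
      δ (x.1.2 (c, true)) (x.1.2 (c, false)) with hF
    -- `F` records the defects at the crossings in `S`. Subtracting a chosen coloring with the same
    -- defects gives one without defects, which obeys `r`; the pair of defects and difference
    -- determines the coloring.
    have hinv : ∀ x, F (Function.invFun F (F x)) = F x := fun x =>
      Function.invFun_eq ⟨x, rfl⟩
    have hcol : ∀ x, D.IsColoring r (x.1 - (Function.invFun F (F x)).1) := fun x => by
      have h1 := A.isColoring_sub x.2 (Function.invFun F (F x)).2
      refine ⟨fun i => ?_, h1.zero⟩
      rw [h _ fun c hc => ?_]
      · exact h1.path i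
      · have h2 := congrFun (hinv x) ⟨c, hc⟩
        simp only [hF] at h2
        rw [Prod.snd_sub, Pi.sub_apply, Pi.sub_apply, hδ, sub_eq_zero]
        exact h2.symm
    have hcard : Nat.card ((S → W) × {y // D.IsColoring r y}) =
        Nat.card W ^ S.card * D.colorings r := by
      rw [Nat.card_prod, Nat.card_fun, Nat.card_eq_fintype_card (α := S), Fintype.card_coe]
      rfl
    rw [← hcard]
    refine Nat.card_le_card_of_injective (fun x => (F x, ⟨_, hcol x⟩)) fun x x' hxx => ?_
    simp only [Prod.mk.injEq, Subtype.mk.injEq] at hxx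
    rw [hxx.1] at hxx
    exact Subtype.ext (sub_left_injective hxx.2)

/-- The colors after the passages if the crossings in `T` are changed. -/
def ruleFlip (A : Switch V) (T : Finset ℕ) (s : ℕ → ℤˣ) (f : ℕ × Bool → V) (a : ℕ × Bool) : V :=
  if a.1 ∈ T then A.out (-s a.1) (!a.2) (f a) (f (a.1, !a.2)) else A.rule s f a

theorem count_crossingChange (A : Switch V) (D : GaussDiagram k) (T : Finset ℕ) :
    A.count (D.crossingChange T) = D.colorings (A.ruleFlip T D.sgn) := by
  have hflip : ∀ a, (GaussDiagram.flip T a).1 = a.1 := fun a => by unfold GaussDiagram.flip; split <;> rfl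
  have hff : GaussDiagram.flip T ∘ GaussDiagram.flip T = id := funext (flip_flip T)
  have hrule : ∀ f : ℕ × Bool → V,
      A.ruleFlip T D.sgn (f ∘ GaussDiagram.flip T) = A.rule (D.crossingChange T).sgn f ∘ GaussDiagram.flip T := by
    intro f
    funext a
    by_cases ha : a.1 ∈ T <;> simp [ruleFlip, rule, crossingChange, GaussDiagram.flip, ha]
  have hpath : ∀ (f : ℕ × Bool → V) (i : Fin k) (v : V),
      Path (f ∘ GaussDiagram.flip T) (A.ruleFlip T D.sgn (f ∘ GaussDiagram.flip T)) v (D.word i) v ↔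
        Path f (A.rule (D.crossingChange T).sgn f) v ((D.crossingChange T).word i) v := by
    intro f i v
    rw [hrule, ← path_map]
    rfl
  apply le_antisymm
  · refine colorings_le (fun x y => y = (x.1, x.2 ∘ GaussDiagram.flip T)) (fun x hx =>
      ⟨(x.1, x.2 ∘ GaussDiagram.flip T), ⟨fun i => (hpath _ _ _).2 (hx.path i), fun a ha => hx.zero _ ?_⟩, rfl⟩) ?_
    · rw [crossings_crossingChange, hflip]
      exact ha
    · rintro x x' y - - rfl h
      simp only [Prod.mk.injEq] at h
      refine Prod.ext h.1 ?_
      have := congrArg (· ∘ GaussDiagram.flip T) h.2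
      simpa [Function.comp_assoc, hff] using this
  · refine colorings_le (fun x y => y = (x.1, x.2 ∘ GaussDiagram.flip T)) (fun x hx =>
      ⟨(x.1, x.2 ∘ GaussDiagram.flip T), ⟨fun i => ?_, fun a ha => hx.zero _ ?_⟩, rfl⟩) ?_
    · rw [← hpath, Function.comp_assoc, hff]
      exact hx.path i
    · rw [crossings_crossingChange] at ha
      rw [hflip]
      exact ha
    · rintro x x' y - - rfl h
      simp only [Prod.mk.injEq] at h
      refine Prod.ext h.1 ?_
      have := congrArg (· ∘ GaussDiagram.flip T) h.2
      simpa [Function.comp_assoc, hff] using this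

/-- A crossing change reverses both the sign and the over-under label, and `hA` says that the rule
does not notice this. -/
theorem count_crossingChange_of_flat (A : Switch V)
    (hA : ∀ s b x y, A.out (-s) (!b) x y = A.out s b x y) (D : GaussDiagram k) (T : Finset ℕ) :
    A.count (D.crossingChange T) = A.count D := by
  rw [count_crossingChange, count]
  congr 1
  funext f a
  rw [ruleFlip, hA]
  exact ite_self _

/-- Where `δ` vanishes the crossing acts on colors like a virtual one. Both argument orders occur in
`h` since `δ` is evaluated on the over-color first, while the rule takes the color of the current
strand first. -/
theorem count_le_virtualize (A : Switch V) (D : GaussDiagram k) (S : Finset ℕ) {W : Type*}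
    [AddCommGroup W] [Finite W] (δ : V → V → W)
    (hδ : ∀ x y x' y', δ (x - x') (y - y') = δ x y - δ x' y')
    (h : ∀ s b x y, δ x y = 0 ∨ δ y x = 0 → A.out s b x y = x) :
    A.count D ≤ Nat.card W ^ S.card * A.count (D.virtualize S) := by
  rw [count_virtualize]
  refine A.count_le_mul D S δ hδ fun f hf => funext fun ⟨c, b⟩ => ?_
  by_cases hc : c ∈ S
  · rw [A.ruleOff_of_mem hc, rule, h]
    cases b
    exacts [Or.inr (hf c hc), Or.inl (hf c hc)]
  · exact A.ruleOff_of_notMem hc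

theorem count_le_crossingChange (A : Switch V) (D : GaussDiagram k) (T : Finset ℕ) {W : Type*}
    [AddCommGroup W] [Finite W] (δ : V → V → W)
    (hδ : ∀ x y x' y', δ (x - x') (y - y') = δ x y - δ x' y')
    (h : ∀ s b x y, δ x y = 0 ∨ δ y x = 0 → A.out s b x y = x) :
    A.count D ≤ Nat.card W ^ T.card * A.count (D.crossingChange T) := by
  rw [count_crossingChange]
  refine A.count_le_mul D T δ hδ fun f hf => funext fun ⟨c, b⟩ => ?_
  by_cases hc : c ∈ T
  · have : δ (f (c, b)) (f (c, !b)) = 0 ∨ δ (f (c, !b)) (f (c, b)) = 0 := by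
      cases b
      exacts [Or.inr (hf c hc), Or.inl (hf c hc)]
    rw [ruleFlip, if_pos (by exact hc), rule, h _ _ _ _ this, h _ _ _ _ this]
  · exact if_neg hc

end Switch

/-! ### Fox colorings -/

/-- Fox colorings: the color of the over-strand is kept, the one of the under-strand is reflected
in it. -/
def foxSwitch (p : ℕ) : Switch (ZMod p) where
  out _ b x y := if b then x else 2 * y - x
  out_sub s b x y x' y' := by cases b <;> simp; ring
  r1 s b x := by
    cases b
    · exact ⟨x, fun y => by
        simp only [Bool.false_eq_true, if_false]
        constructor <;> intro h <;> linear_combination -h⟩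
    · exact ⟨x, fun y => by simp⟩
  r1_out s b x y := by
    cases b
    · intro h
      simp only [Bool.false_eq_true, if_false, Bool.not_false, if_true] at h ⊢
      linear_combination -h
    · intro h
      simp only [Bool.not_true, Bool.false_eq_true, if_false, if_true] at h ⊢
      linear_combination -h
  r2 s b x y := by cases b <;> simp
  r2' s x y := ⟨x, 2 * x - y, fun x' y' => by
    simp only [if_true, Bool.false_eq_true, if_false]
    constructor <;> rintro ⟨rfl, rfl⟩ <;> simp⟩
  r2'_out s x y x' y' := by
    simp only [if_true, Bool.false_eq_true, if_false]
    rintro rfl rfl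
    simp
  opposite s e e' oi oo ui uo oi' oo' ui' uo' := by
    simp only [Fits, if_true, Bool.false_eq_true, if_false]
    rintro ⟨rfl, rfl⟩ ⟨rfl, rfl⟩
    rcases Int.units_eq_one_or e with rfl | rfl <;> rcases Int.units_eq_one_or e' with rfl | rfl <;>
      simp only [pick_one, pick_neg_one] <;> rintro rfl h
    · simp [h]
    · simp only [true_and]; linear_combination -h
    · simp [h]
    · simp only [true_and]; linear_combination -h
  r3 eT eM eB sx sy sz h₁ h₂ T₀ T₁ T₂ M₀ M₁ M₂ B₀ B₁ B₂ := by
    -- The top color is constant. `M₁` is one of `M₀`, `M₂`, and after the move the inner middle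
    -- color is the other one. The bottom color is reflected in the top color at `y`, which now
    -- comes last or first according to `eB`.
    refine fun h => ⟨T₁, M₀ + M₂ - M₁, pick eB (2 * T₁ - B₂) (2 * T₁ - B₀), ?_⟩
    clear h₁ h₂
    revert h
    rcases Int.units_eq_one_or eT with rfl | rfl <;>
      rcases Int.units_eq_one_or eM with rfl | rfl <;>
      rcases Int.units_eq_one_or eB with rfl | rfl <;>
      simp only [Triangle, Fits, pick_one, pick_neg_one, neg_neg, if_true, Bool.false_eq_true,
        if_false] <;>
      rintro ⟨⟨h1, h2⟩, ⟨h3, h4⟩, ⟨h5, h6⟩⟩ <;>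
      refine ⟨⟨?_, ?_⟩, ⟨?_, ?_⟩, ⟨?_, ?_⟩⟩ <;> grind

/-! ### Flat colorings over the field with four elements -/

namespace FlatSwitch

/-- The field with four elements as an additive group; `(a, b)` stands for `a + b ω`. -/
abbrev F : Type := ZMod 2 × ZMod 2

/-- The conjugate of an element. -/
def conj (x : F) : F := (x.1 + x.2, x.2)

/-- The product of an element with `ω`. -/
def mulω (x : F) : F := (x.2, x.1 + x.2)

/-- The product of an element with `ω²`. -/
def mulω' (x : F) : F := (x.1 + x.2, x.1)

/-- The color of a strand behind a crossing does not depend on the over-under information, but on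
the side from which the other strand comes. -/
def out (s : ℤˣ) (b : Bool) (x y : F) : F :=
  if b = decide (s = 1) then mulω' (conj x + y) else conj x + mulω y

/-- The colors of the over- and the under-strand on one side of a crossing, computed from their
colors `a` and `b` on the opposite side. The units `e` and `e'` record whether `a` and `b`
are the colors before or behind the crossing. -/
def corner (s e e' : ℤˣ) (a b : F) : F × F :=
  if e = e' then (out (s * e) true a b, out (s * e) false b a)
  else if e = s then (conj a + mulω' (conj b), mulω' (conj a) + conj b)
  else (mulω' (conj a) + conj b, conj a + mulω' (conj b))

theorem out_flat (s : ℤˣ) (b : Bool) (x y : F) : out (-s) (!b) x y = out s b x y := by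
  rcases Int.units_eq_one_or s with rfl | rfl <;> cases b <;> simp [out]

theorem fits_corner {s : ℤˣ} (e e' : ℤˣ) {oi oo ui uo : F} (h : Fits out s oi oo ui uo) :
    pick e oo oi = (corner s e e' (pick e oi oo) (pick e' ui uo)).1 ∧
      pick e' uo ui = (corner s e e' (pick e oi oo) (pick e' ui uo)).2 := by
  obtain ⟨rfl, rfl⟩ := h
  revert oi ui
  rcases Int.units_eq_one_or s with rfl | rfl <;> rcases Int.units_eq_one_or e with rfl | rfl <;>
    rcases Int.units_eq_one_or e' with rfl | rfl <;> decide

/-- The three inner colors determine the six outer ones via `fits_corner`, so each admissible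
pattern of signs and orders leaves 64 cases. The new inner colors are computed across the vertices
`x` and `y` from the outer ones. -/
theorem exists_triangle {eT eM eB sx sy sz : ℤˣ} (h₁ : sx * eM = sy * eB)
    (h₂ : sz * eM = sy * eT) {T₀ T₁ T₂ M₀ M₁ M₂ B₀ B₁ B₂ : F}
    (h : Triangle out eT eM eB sx sy sz T₀ T₁ T₂ M₀ M₁ M₂ B₀ B₁ B₂) : ∃ T M B,
      Triangle out (-eT) (-eM) (-eB) sx sy sz T₀ T T₂ M₀ M M₂ B₀ B B₂ := by
  have hx := fits_corner (-eT) (-eM) h.1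
  have hy := fits_corner eT (-eB) h.2.1
  have hz := fits_corner eM eB h.2.2
  refine ⟨(corner sx (-eT) (-eM) (pick eT T₂ T₀) (pick eM M₂ M₀)).1,
    (corner sx (-eT) (-eM) (pick eT T₂ T₀) (pick eM M₂ M₀)).2,
    (corner sy eT (-eB) (pick eT T₀ T₂) (pick eB B₂ B₀)).2, ?_⟩
  clear h
  revert h₁ h₂ hx hy hz
  rcases Int.units_eq_one_or eT with rfl | rfl <;> rcases Int.units_eq_one_or eM with rfl | rfl <;>
    rcases Int.units_eq_one_or eB with rfl | rfl <;>
    rcases Int.units_eq_one_or sx with rfl | rfl <;>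
    rcases Int.units_eq_one_or sy with rfl | rfl <;>
    rcases Int.units_eq_one_or sz with rfl | rfl <;> intro h₁ h₂ <;>
    first
    | exact absurd h₁ (by decide)
    | exact absurd h₂ (by decide)
    | (clear h₁ h₂
       simp only [pick_one, pick_neg_one, neg_neg]
       rintro ⟨rfl, rfl⟩ ⟨rfl, rfl⟩ ⟨rfl, rfl⟩
       unfold Triangle Fits
       revert T₁ M₁ B₁
       decide)

end FlatSwitch

open FlatSwitch in
/-- Colorings by the field with four elements that do not depend on the over-under information. -/
def flatSwitch : Switch F where
  out := out
  out_sub s b := by rcases Int.units_eq_one_or s with rfl | rfl <;> cases b <;> decide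
  r1 s b := by rcases Int.units_eq_one_or s with rfl | rfl <;> cases b <;> decide
  r1_out s b := by rcases Int.units_eq_one_or s with rfl | rfl <;> cases b <;> decide
  r2 s b := by rcases Int.units_eq_one_or s with rfl | rfl <;> cases b <;> decide
  r2' s := by rcases Int.units_eq_one_or s with rfl | rfl <;> decide
  r2'_out s := by rcases Int.units_eq_one_or s with rfl | rfl <;> decide
  opposite s e e' oi oo ui uo oi' oo' ui' uo' h h' h₁ h₂ := by
    have h₃ := fits_corner e e' h
    rw [h₁, h₂] at h₃
    have h₄ := fits_corner e e' h'
    exact ⟨h₃.1.trans h₄.1.symm, h₃.2.trans h₄.2.symm⟩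
  r3 _ _ _ _ _ _ h₁ h₂ _ _ _ _ _ _ _ _ _ := exists_triangle h₁ h₂

/-! ### Long diagrams and their insertion -/

/-- A Gauss diagram on an oriented line. -/
structure LongDiagram where
  word : List (ℕ × Bool)
  sgn : ℕ → ℤˣ
  nodup : word.Nodup
  paired : ∀ c b, (c, b) ∈ word → (c, !b) ∈ word

namespace LongDiagram

/-- Virtualization of the crossings in `S`. -/
def virtualize (X : LongDiagram) (S : Finset ℕ) : LongDiagram where
  word := X.word.filter fun a => a.1 ∉ S
  sgn := X.sgn
  nodup := X.nodup.filter _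
  paired c b h := by
    rw [List.mem_filter] at h ⊢
    exact ⟨X.paired c b h.1, h.2⟩

/-- Crossing change at the crossings in `T`. -/
def crossingChange (X : LongDiagram) (T : Finset ℕ) : LongDiagram where
  word := X.word.map (GaussDiagram.flip T)
  sgn c := if c ∈ T then -X.sgn c else X.sgn c
  nodup := X.nodup.map (Function.LeftInverse.injective (GaussDiagram.flip_flip T))
  paired c b h := by
    rw [GaussDiagram.mem_map_flip] at h ⊢
    rw [GaussDiagram.flip_not]
    exact X.paired _ _ h

/-- Long diagrams all of whose crossings can be removed by Reidemeister moves of type one and two. -/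
inductive Null : LongDiagram → Prop
  | nil (X : LongDiagram) (h : X.word = []) : Null X
  | r1 (X : LongDiagram) (c : ℕ) (b : Bool) (h : [(c, b), (c, !b)] <:+: X.word)
      (hX : Null (X.virtualize {c})) : Null X
  | r2 (X : LongDiagram) (c d : ℕ) (hcd : c ≠ d) (hs : X.sgn c = -X.sgn d)
      (ho : [(c, true), (d, true)] <:+: X.word ∨ [(d, true), (c, true)] <:+: X.word)
      (hu : [(c, false), (d, false)] <:+: X.word ∨ [(d, false), (c, false)] <:+: X.word)
      (hX : Null (X.virtualize {c, d})) : Null X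

/-- The strand retraces its own path. The two innermost passages belong to one crossing and form a
kink; removing it leaves a shorter palindrome. -/
theorem null_of_palindrome (l : List (ℕ × Bool)) (X : LongDiagram)
    (h : X.word = l ++ (l.map fun a => (a.1, !a.2)).reverse) : X.Null := by
  induction l using List.reverseRecOn generalizing X with
  | nil => exact .nil X h
  | append_singleton l a ih =>
    have h' : X.word = l ++ [a, (a.1, !a.2)] ++ (l.map fun a => (a.1, !a.2)).reverse := by
      simp [h]
    refine .r1 X a.1 a.2 ⟨l, _, h'.symm⟩ (ih _ ?_)
    have hl : ∀ b ∈ l, b.1 ≠ a.1 := by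
      rintro ⟨c, b⟩ hb rfl
      have hnd := X.nodup
      rw [h', List.append_assoc, List.nodup_append] at hnd
      have h1 := hnd.2.2 _ hb a (by simp)
      have h2 := hnd.2.2 _ hb (a.1, !a.2) (by simp)
      rcases a with ⟨c, b'⟩
      cases b <;> cases b' <;> simp_all
    have h1 : (l.filter fun b => b.1 ∉ ({a.1} : Finset ℕ)) = l :=
      List.filter_eq_self.2 fun b hb => by simpa using hl b hb
    simp only [virtualize, h', List.filter_append, h1]
    congr 1
    · simp
    · refine List.filter_eq_self.2 fun b hb => ?_
      simp only [List.mem_reverse, List.mem_map] at hb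
      obtain ⟨b, hb, rfl⟩ := hb
      simpa using hl b hb

end LongDiagram

namespace GaussDiagram

variable {k : ℕ}

/-- The long diagram `X` is inserted at the base point of the component `i₀`; its crossings
are renamed by adding `N`. -/
def insert (D : GaussDiagram k) (i₀ : Fin k) (N : ℕ) (hN : ∀ c ∈ D.crossings, c < N)
    (X : LongDiagram) : GaussDiagram k where
  word i := D.word i ++ if i = i₀ then X.word.map (Prod.map (· + N) id) else []
  sgn c := if c < N then D.sgn c else X.sgn (c - N)
  nodup i := by
    refine List.nodup_append.2 ⟨D.nodup i, ?_, fun a ha b hb hab => ?_⟩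
    · split
      · exact X.nodup.map ((add_left_injective N).prodMap Function.injective_id)
      · exact List.nodup_nil
    · subst hab
      split at hb
      · obtain ⟨b, -, rfl⟩ := List.mem_map.1 hb
        have := hN _ (mem_crossings_of_mem ha)
        simp at this
      · simp at hb
  disjoint i j a hi hj := by
    rw [List.mem_append] at hi hj
    rcases hi with hi | hi <;> rcases hj with hj | hj
    · exact D.disjoint i j a hi hj
    · split at hj
      · obtain ⟨b, -, rfl⟩ := List.mem_map.1 hj
        have := hN _ (mem_crossings_of_mem hi)
        simp at this
      · simp at hj
    · split at hi
      · obtain ⟨b, -, rfl⟩ := List.mem_map.1 hi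
        have := hN _ (mem_crossings_of_mem hj)
        simp at this
      · simp at hi
    · split at hi
      · split at hj
        · simp_all
        · simp at hj
      · simp at hi
  paired i c b h := by
    rw [List.mem_append] at h
    rcases h with h | h
    · obtain ⟨j, hj⟩ := D.paired i c b h
      exact ⟨j, List.mem_append_left _ hj⟩
    · split at h
      · obtain ⟨⟨c', b'⟩, ha, hab⟩ := List.mem_map.1 h
        simp only [Prod.map_apply, id, Prod.mk.injEq] at hab
        obtain ⟨rfl, rfl⟩ := hab
        refine ⟨i₀, List.mem_append_right _ ?_⟩
        rw [if_pos rfl]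
        exact List.mem_map.2 ⟨_, X.paired _ _ ha, rfl⟩
      · simp at h

theorem lt_of_mem_crossings_virtualize {D : GaussDiagram k} {N : ℕ}
    (hN : ∀ c ∈ D.crossings, c < N) (S : Finset ℕ) : ∀ c ∈ (D.virtualize S).crossings, c < N := by
  rw [crossings_virtualize]
  exact fun c hc => hN c (Finset.mem_sdiff.1 hc).1

theorem lt_of_mem_crossings_crossingChange {D : GaussDiagram k} {N : ℕ}
    (hN : ∀ c ∈ D.crossings, c < N) (T : Finset ℕ) :
    ∀ c ∈ (D.crossingChange T).crossings, c < N := by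
  rw [crossings_crossingChange]
  exact hN

variable {D : GaussDiagram k} {i₀ : Fin k} {N : ℕ} (hN : ∀ c ∈ D.crossings, c < N)

theorem insert_virtualize (X : LongDiagram) {S : Finset ℕ} (hS : S ⊆ D.crossings) (S' : Finset ℕ) :
    (D.insert i₀ N hN X).virtualize (S ∪ S'.map (addRightEmbedding N)) =
      (D.virtualize S).insert i₀ N (lt_of_mem_crossings_virtualize hN S) (X.virtualize S') := by
  refine eq_of_word_eq (fun i => ?_) rfl
  simp only [virtualize, LongDiagram.virtualize, insert, List.filter_append]
  congr 1
  · refine List.filter_congr fun a ha => ?_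
    have := hN _ (mem_crossings_of_mem ha)
    simp only [Finset.mem_union, Finset.mem_map, addRightEmbedding_apply]
    congr 1
    simp only [not_or, not_exists, not_and, eq_iff_iff, and_iff_left_iff_imp]
    omega
  · split
    · rw [List.filter_map]
      congr 1
      refine List.filter_congr fun a ha => ?_
      have : a.1 + N ∉ S := fun h => by
        have := hN _ (hS h)
        omega
      simp [this]
    · rfl

theorem insert_crossingChange (X : LongDiagram) {T : Finset ℕ} (hT : T ⊆ D.crossings)
    (T' : Finset ℕ) :
    (D.insert i₀ N hN X).crossingChange (T ∪ T'.map (addRightEmbedding N)) =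
      (D.crossingChange T).insert i₀ N (lt_of_mem_crossings_crossingChange hN T)
        (X.crossingChange T') := by
  have hlt : ∀ c ∈ T, c < N := fun c hc => hN _ (hT hc)
  refine eq_of_word_eq (fun i => ?_) (funext fun c => ?_)
  · simp only [crossingChange, LongDiagram.crossingChange, insert, List.map_append]
    congr 1
    · refine List.map_congr_left fun a ha => ?_
      have := hN _ (mem_crossings_of_mem ha)
      have : a.1 ∉ T'.map (addRightEmbedding N) := by
        simp only [Finset.mem_map, addRightEmbedding_apply]
        omega
      simp [flip, this]
    · split
      · simp only [List.map_map]
        refine List.map_congr_left fun a ha => ?_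
        have : a.1 + N ∉ T := fun h => by
          have := hlt _ h
          omega
        by_cases ha : a.1 ∈ T' <;> simp [flip, this, ha]
      · rfl
  · simp only [crossingChange, LongDiagram.crossingChange, insert]
    by_cases hc : c < N
    · have : c ∉ T'.map (addRightEmbedding N) := by
        simp only [Finset.mem_map, addRightEmbedding_apply]
        omega
      simp only [Finset.mem_union, this, or_false, if_pos hc]
    · have h1 : c ∉ T := fun h => hc (hlt c h)
      have h2 : c ∈ T'.map (addRightEmbedding N) ↔ c - N ∈ T' := by
        simp only [Finset.mem_map, addRightEmbedding_apply]
        constructor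
        · rintro ⟨a, ha, rfl⟩
          simpa using ha
        · intro h
          exact ⟨_, h, by omega⟩
      simp only [Finset.mem_union, h1, h2, false_or, if_neg hc]

theorem adj_insert {X : LongDiagram} {a b : ℕ × Bool} (h : [a, b] <:+: X.word) :
    (D.insert i₀ N hN X).Adj (Prod.map (· + N) id a) (Prod.map (· + N) id b) := by
  obtain ⟨u, t, h⟩ := h
  refine ⟨i₀, t.map (Prod.map (· + N) id) ++ (D.word i₀ ++ u.map (Prod.map (· + N) id)), ?_⟩
  have : (D.insert i₀ N hN X).word i₀ = (D.word i₀ ++ u.map (Prod.map (· + N) id)) ++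
      (Prod.map (· + N) id a :: Prod.map (· + N) id b :: t.map (Prod.map (· + N) id)) := by
    simp [insert, ← h]
  rw [this]
  exact List.isRotated_append

/-- Passages that are consecutive in `X` remain so after insertion, so each removal in `X` is a
Reidemeister move of the whole diagram. -/
theorem insert_equiv {X : LongDiagram} (hX : X.Null) : D.insert i₀ N hN X ≈ D := by
  have hv : ∀ (X : LongDiagram) (S : Finset ℕ),
      (D.insert i₀ N hN X).virtualize (S.map (addRightEmbedding N)) ≈
        D.insert i₀ N hN (X.virtualize S) := by
    intro X S
    have h := insert_virtualize (i₀ := i₀) hN X (Finset.empty_subset _) S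
    rw [Finset.empty_union] at h
    rw [h]
    exact .rel _ _ (.iso _ _ (iso_of_word_eq (fun i => by simp [insert, virtualize])
      fun c _ => rfl))
  induction hX with
  | nil X h =>
    refine .rel _ _ (.iso _ _ (iso_of_word_eq (fun i => ?_) fun c hc => ?_))
    · simp [insert, h]
    · have : c < N := by
        obtain ⟨i, b, hi⟩ := mem_crossings.1 hc
        refine hN _ (mem_crossings.2 ⟨i, b, ?_⟩)
        simpa [insert, h] using hi
      simp [insert, this]
  | r1 X c b h hX ih =>
    refine Setoid.trans (.rel _ _ (.r1 _ (c + N) b (adj_insert hN h))) (Setoid.trans ?_ ih)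
    have := hv X {c}
    rwa [Finset.map_singleton] at this
  | r2 X c d hcd hs ho hu hX ih =>
    refine Setoid.trans (.rel _ _ (.r2 _ (c + N) (d + N) (by omega) (by simpa [insert] using hs)
      (ho.imp (adj_insert hN) (adj_insert hN)) (hu.imp (adj_insert hN) (adj_insert hN))))
      (Setoid.trans ?_ ih)
    have := hv X {c, d}
    rwa [Finset.map_insert, Finset.map_singleton] at this

theorem mem_crossings_insert {X : LongDiagram} {c : ℕ} {b : Bool} (h : (c, b) ∈ X.word) :
    c + N ∈ (D.insert i₀ N hN X).crossings := by
  refine mem_crossings.2 ⟨i₀, b, List.mem_append_right _ ?_⟩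
  rw [if_pos rfl]
  exact List.mem_map.2 ⟨_, h, rfl⟩

theorem crossings_subset_insert (X : LongDiagram) :
    D.crossings ⊆ (D.insert i₀ N hN X).crossings := by
  intro c hc
  obtain ⟨i, b, h⟩ := mem_crossings.1 hc
  exact mem_crossings.2 ⟨i, b, List.mem_append_left _ h⟩

theorem crossings_insert {X : LongDiagram} {c : ℕ} (h : c ∈ (D.insert i₀ N hN X).crossings) :
    c ∈ D.crossings ∨ N ≤ c ∧ ∀ b, (c - N, b) ∈ X.word := by
  obtain ⟨i, b, h⟩ := mem_crossings.1 h
  rcases List.mem_append.1 h with h | h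
  · exact Or.inl (mem_crossings_of_mem h)
  · split at h
    · obtain ⟨⟨c', b'⟩, ha, hab⟩ := List.mem_map.1 h
      simp only [Prod.map_apply, id, Prod.mk.injEq] at hab
      obtain ⟨rfl, rfl⟩ := hab
      refine Or.inr ⟨by omega, fun b => ?_⟩
      rw [Nat.add_sub_cancel]
      have := X.paired _ _ ha
      cases b <;> cases b' <;> assumption
    · simp at h

end GaussDiagram

/-! ### Colorings after insertion -/

namespace Switch

open GaussDiagram

variable {V : Type*} [AddCommGroup V] {k : ℕ} {D : GaussDiagram k} {i₀ : Fin k} {N : ℕ}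
  (hN : ∀ c ∈ D.crossings, c < N)

theorem path_insert (A : Switch V) (X : LongDiagram) (f : ℕ × Bool → V) (v w : V) :
    Path f (A.rule (D.insert i₀ N hN X).sgn f) v (X.word.map (Prod.map (· + N) id)) w ↔
      Path (f ∘ Prod.map (· + N) id) (A.rule X.sgn (f ∘ Prod.map (· + N) id)) v X.word w := by
  rw [path_map]
  have : A.rule (D.insert i₀ N hN X).sgn f ∘ Prod.map (· + N) id =
      A.rule X.sgn (f ∘ Prod.map (· + N) id) := by
    funext a
    simp [rule, GaussDiagram.insert]
  rw [this]

theorem rule_insert_of_mem (A : Switch V) (X : LongDiagram) {f f' : ℕ × Bool → V} {i : Fin k}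
    {a : ℕ × Bool} (ha : a ∈ D.word i) (hf : ∀ a : ℕ × Bool, a.1 < N → f' a = f a) :
    A.rule (D.insert i₀ N hN X).sgn f' a = A.rule D.sgn f a := by
  have := hN _ (mem_crossings_of_mem ha)
  rw [rule, rule, hf a this, hf _ (by exact this)]
  simp [GaussDiagram.insert, this]

variable [Finite V]

/-- If the colors of the ends of `X` can be prescribed to be equal, with at least `|Z|`
possibilities for the colors in between, then insertion of `X` multiplies the number of colorings
at least by `|Z|`. -/
theorem mul_count_le_count_insert (A : Switch V) (X : LongDiagram) {Z : Type*} [Finite Z]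
    (g : V → Z → ℕ × Bool → V) (hg : ∀ v z, Path (g v z) (A.rule X.sgn (g v z)) v X.word v)
    (hinj : ∀ v z z', (∀ a ∈ X.word, g v z a = g v z' a) → z = z') :
    Nat.card Z * A.count D ≤ A.count (D.insert i₀ N hN X) := by
  classical
  set F : ((Fin k → V) × (ℕ × Bool → V)) → Z → ℕ × Bool → V := fun x z a =>
    if a.1 < N then x.2 a else if (a.1 - N, a.2) ∈ X.word then g (x.1 i₀) z (a.1 - N, a.2) else 0
    with hF
  have hFlt : ∀ x z (a : ℕ × Bool), a.1 < N → F x z a = x.2 a := fun x z a ha => if_pos ha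
  have hFX : ∀ x z, ∀ a ∈ X.word, F x z (Prod.map (· + N) id a) = g (x.1 i₀) z a := by
    intro x z a ha
    simp [hF, ha]
  have hcol : ∀ z x, D.IsColoring (A.rule D.sgn) x → (D.insert i₀ N hN X).IsColoring
      (A.rule (D.insert i₀ N hN X).sgn) (x.1, F x z) := by
    refine fun z x hx => ⟨fun i => path_append.2 ⟨x.1 i, ?_, ?_⟩, fun a ha => ?_⟩
    · refine (hx.path i).congr (fun a ha => hFlt _ _ _ (hN _ (mem_crossings_of_mem ha)))
        fun a ha => A.rule_insert_of_mem hN X ha (hFlt x z)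
    · split
      next h =>
        subst h
        rw [path_insert]
        refine (hg (x.1 i) z).congr (fun a ha => hFX x z a ha) fun a ha => ?_
        have h1 := hFX x z a ha
        have h2 := hFX x z _ (X.paired _ _ ha)
        simp only [rule, Function.comp_apply, h1, h2]
      next => rfl
    · change F x z a = 0
      simp only [hF]
      split
      · exact hx.zero _ fun h => ha (crossings_subset_insert hN X h)
      · split
        next h1 h2 =>
          refine absurd ?_ ha
          have := mem_crossings_insert (i₀ := i₀) hN h2
          rwa [Nat.sub_add_cancel (not_lt.1 h1)] at this
        next => rfl
  rw [count, colorings, ← Nat.card_prod]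
  refine Nat.card_le_card_of_injective (fun zx => (⟨_, hcol zx.1 zx.2.1 zx.2.2⟩ :
    {y // (D.insert i₀ N hN X).IsColoring (A.rule (D.insert i₀ N hN X).sgn) y})) ?_
  rintro ⟨z, x, hx⟩ ⟨z', x', hx'⟩ h
  simp only [Subtype.mk.injEq, Prod.mk.injEq] at h
  obtain ⟨h1, h2⟩ := h
  have hxx : x = x' := by
    refine Prod.ext h1 (funext fun a => ?_)
    by_cases ha : a.1 < N
    · rw [← hFlt x z a ha, h2, hFlt x' z' a ha]
    · rw [hx.zero _ fun h => ha (hN _ h), hx'.zero _ fun h => ha (hN _ h)]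
  subst hxx
  have : z = z' := hinj (x.1 i₀) z z' fun a ha => by rw [← hFX x z a ha, h2, hFX x z' a ha]
  subst this
  rfl

/-- If `X` has only constant colorings, then its insertion does not increase the number of
colorings. -/
theorem count_insert_le (A : Switch V) (X : LongDiagram)
    (hX : ∀ f u w, Path f (A.rule X.sgn f) u X.word w → u = w ∧ ∀ a ∈ X.word, f a = u) :
    A.count (D.insert i₀ N hN X) ≤ A.count D := by
  have key : ∀ y, (D.insert i₀ N hN X).IsColoring (A.rule (D.insert i₀ N hN X).sgn) y →
      (∀ i, Path y.2 (A.rule (D.insert i₀ N hN X).sgn y.2) (y.1 i) (D.word i) (y.1 i)) ∧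
        ∀ a ∈ X.word, y.2 (Prod.map (· + N) id a) = y.1 i₀ := by
    intro y hy
    have h : ∀ i, Path y.2 (A.rule (D.insert i₀ N hN X).sgn y.2) (y.1 i) (D.word i) (y.1 i) ∧
        (i = i₀ → ∀ a ∈ X.word, y.2 (Prod.map (· + N) id a) = y.1 i₀) := by
      intro i
      obtain ⟨u, h1, h2⟩ := path_append.1 (hy.path i)
      split at h2
      next h =>
        subst h
        rw [path_insert] at h2
        obtain ⟨rfl, h3⟩ := hX _ _ _ h2
        exact ⟨h1, fun _ => h3⟩
      next h =>
        cases h2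
        exact ⟨h1, fun h' => absurd h' h⟩
    exact ⟨fun i => (h i).1, (h i₀).2 rfl⟩
  refine colorings_le (fun y x => y.1 = x.1 ∧ ∀ a : ℕ × Bool, a.1 < N → y.2 a = x.2 a)
    (fun y hy => ⟨(y.1, fun a => if a.1 < N then y.2 a else 0), ⟨fun i => ?_, fun a ha => ?_⟩, rfl,
      fun a ha => (if_pos ha).symm⟩) ?_
  · refine ((key y hy).1 i).congr (fun a ha => if_pos (hN _ (mem_crossings_of_mem ha)))
      fun a ha => ?_
    exact (A.rule_insert_of_mem hN X ha fun a ha => (if_pos ha).symm).symm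
  · change (if a.1 < N then y.2 a else 0) = 0
    split
    next h =>
      refine hy.zero a fun h' => ?_
      rcases crossings_insert hN h' with h' | h'
      · exact ha h'
      · omega
    next => rfl
  · rintro y y' x hy hy' ⟨h1, h2⟩ ⟨h1', h2'⟩
    have h12 := h1.trans h1'.symm
    refine Prod.ext h12 (funext fun a => ?_)
    by_cases ha : a.1 < N
    · rw [h2 a ha, h2' a ha]
    · by_cases hc : a.1 ∈ (D.insert i₀ N hN X).crossings
      · rcases crossings_insert hN hc with h' | h'
        · exact absurd (hN _ h') ha
        · have e1 := (key y hy).2 _ (h'.2 a.2)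
          have e2 := (key y' hy').2 _ (h'.2 a.2)
          have : Prod.map (· + N) id (a.1 - N, a.2) = a := Prod.ext (Nat.sub_add_cancel h'.1) rfl
          rw [this] at e1 e2
          rw [e1, e2, h12]
      · rw [hy.zero a hc, hy'.zero a hc]

/-- Additivity forces `out s b 0 0 = 0`, so the zero coloring always exists. -/
theorem count_pos (A : Switch V) (D : GaussDiagram k) : 0 < A.count D := by
  have h0 : ∀ s b, A.out s b 0 0 = 0 := fun s b => by
    have := A.out_sub s b 0 0 0 0
    simpa using this
  have hr : A.rule D.sgn 0 = 0 := funext fun a => h0 _ _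
  have hp : ∀ l : List (ℕ × Bool), Path (0 : ℕ × Bool → V) 0 0 l 0 := fun l => by
    induction l with
    | nil => rfl
    | cons a l ih => exact ⟨rfl, ih⟩
  have : Nonempty {x // D.IsColoring (A.rule D.sgn) x} := ⟨0, fun i => by
    rw [Prod.snd_zero, hr]
    exact hp _, fun _ _ => rfl⟩
  exact Nat.card_pos

end Switch

/-! ### The flat clasp -/

open GaussDiagram

/-- A long diagram with nontrivial flat colorings whose crossings can be removed by Reidemeister
moves after virtualization of the crossing `0`. -/
def flatClasp : LongDiagram where
  word := [(3, true), (2, true), (3, false), (0, false), (1, false), (0, true), (1, true), (2, false)]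
  sgn c := if c = 3 then -1 else 1
  nodup := by decide
  paired c b h := by
    simp only [List.mem_cons, Prod.mk.injEq, List.not_mem_nil, or_false] at h ⊢
    cases b <;> simp_all <;> omega

/-- Without crossing 0, crossing 1 is a kink; once it is gone, 3 and 2 have opposite signs and form
a second Reidemeister pair. -/
theorem flatClasp_null : (flatClasp.virtualize {0}).Null := by
  refine .r1 _ 1 false ⟨[(3, true), (2, true), (3, false)], [(2, false)], by decide⟩ ?_
  refine .r2 _ 3 2 (by decide) (by decide) (Or.inl ⟨[], [(3, false), (2, false)], by decide⟩)
    (Or.inl ⟨[(3, true), (2, true)], [], by decide⟩) (.nil _ (by decide))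

/-- Flat colorings of `flatClasp` with the color `v` at both ends. -/
def flatClaspColoring (v : FlatSwitch.F) (z : ZMod 2) : ℕ × Bool → FlatSwitch.F
  | (3, true) => v
  | (2, true) => 0
  | (3, false) => (v.1, v.1 + v.2)
  | (0, false) => (v.2, v.1 + v.2)
  | (1, false) => (z, v.1 + v.2)
  | (0, true) => (v.1 + z, v.1 + z)
  | (1, true) => (z, v.2)
  | (2, false) => (v.1 + v.2, v.2)
  | _ => 0

theorem path_flatClasp (v : FlatSwitch.F) (z : ZMod 2) :
    Path (flatClaspColoring v z) (flatSwitch.rule flatClasp.sgn (flatClaspColoring v z)) v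
      flatClasp.word v := by
  revert v z
  simp only [flatClasp, GaussDiagram.Path]
  decide

theorem two_mul_count_le_count_insert_flatClasp {k : ℕ} {D : GaussDiagram k} {i₀ : Fin k} {N : ℕ}
    (hN : ∀ c ∈ D.crossings, c < N) :
    2 * flatSwitch.count D ≤ flatSwitch.count (D.insert i₀ N hN flatClasp) := by
  have := flatSwitch.mul_count_le_count_insert (i₀ := i₀) hN flatClasp flatClaspColoring
    path_flatClasp fun v z z' h => by
      -- The free parameter `z` is the first coordinate of the color at this passage.
      have := h (1, true) (by decide)
      exact congrArg Prod.fst this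
  rwa [Nat.card_zmod] at this

/-! ### Twisted clasps and their Fox colorings -/

namespace GaussDiagram

/-- Turns a path through a row of crossings into a recurrence for the colors `P j` between them. -/
theorem path_map_range {α V : Type*} {f q : α → V} (t : ℕ → α) {n : ℕ} {v w : V} :
    Path f q v ((List.range n).map t) w ↔
      ∃ P : ℕ → V, P 0 = v ∧ P n = w ∧ ∀ j < n, f (t j) = P j ∧ q (t j) = P (j + 1) := by
  induction n generalizing w with
  | zero => exact ⟨fun h => ⟨fun _ => v, rfl, h, by simp⟩, fun ⟨P, h, h', _⟩ => h.symm.trans h'⟩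
  | succ n ih =>
    rw [List.range_succ, List.map_append, path_append]
    simp only [ih, List.map_cons, List.map_nil, Path]
    constructor
    · rintro ⟨u, ⟨P, h0, hn, h⟩, h1, h2⟩
      refine ⟨fun j => if j ≤ n then P j else w, by simpa using h0, by simp, fun j hj => ?_⟩
      rcases (Nat.lt_succ_iff_lt_or_eq.1 hj) with hj | rfl
      · simpa [hj.le, Nat.succ_le_of_lt hj] using h j hj
      · simpa [hn] using ⟨h1, h2⟩
    · rintro ⟨P, h0, hn, h⟩
      exact ⟨P n, ⟨P, h0, rfl, fun j hj => h j (by omega)⟩, (h n (by omega)).1,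
        (h n (by omega)).2.trans hn⟩

theorem path_map_range_reverse {α V : Type*} {f q : α → V} (t : ℕ → α) {n : ℕ} {v w : V} :
    Path f q v ((List.range n).map t).reverse w ↔
      ∃ P : ℕ → V, P n = v ∧ P 0 = w ∧ ∀ j < n, f (t j) = P (j + 1) ∧ q (t j) = P j := by
  induction n generalizing v with
  | zero => exact ⟨fun h => ⟨fun _ => v, rfl, h, by simp⟩, fun ⟨P, h, h', _⟩ => h.symm.trans h'⟩
  | succ n ih =>
    rw [List.range_succ, List.map_append, List.reverse_append]
    simp only [List.map_cons, List.map_nil, List.reverse_singleton, List.singleton_append, Path, ih]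
    constructor
    · rintro ⟨h1, P, h0, hn, h⟩
      refine ⟨fun j => if j ≤ n then P j else v, by simp, by simpa using hn, fun j hj => ?_⟩
      rcases (Nat.lt_succ_iff_lt_or_eq.1 hj) with hj | rfl
      · simpa [hj.le, Nat.succ_le_of_lt hj] using h j hj
      · simpa using ⟨h1, h0.symm⟩
    · rintro ⟨P, h0, hn, h⟩
      exact ⟨(h n (by omega)).1.trans h0, P, (h n (by omega)).2.symm, hn,
        fun j hj => h j (by omega)⟩

end GaussDiagram

/-- A twist region with `2 * r` crossings, closed by a clasp that consists of the
crossings `0` and `1`. -/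
def twistClasp (r : ℕ) : LongDiagram where
  word := (0, true) :: (1, false) :: (List.range (2 * r)).map (fun j => (j + 2, j % 2 == 0)) ++
    (1, true) :: (0, false) ::
      ((List.range (2 * r)).map fun j => (j + 2, !(j % 2 == 0))).reverse
  sgn _ := 1
  nodup := by
    have h : ∀ g : ℕ → Bool, ((List.range (2 * r)).map fun j => (j + 2, g j)).Nodup := fun g =>
      List.nodup_range.map fun i j h => by simpa using congrArg Prod.fst h
    rw [List.nodup_append]
    refine ⟨?_, ?_, ?_⟩
    · simp [h]
    · simp [h]
    · intro a ha b hb hab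
      subst hab
      simp only [List.mem_cons, List.mem_map, List.mem_reverse] at ha hb
      rcases ha with rfl | rfl | ⟨i, -, rfl⟩ <;> rcases hb with hb | hb | ⟨j, -, hb⟩ <;>
        simp only [Prod.mk.injEq] at hb
      all_goals first | omega | simp at hb
      obtain ⟨h1, h2⟩ := hb
      obtain rfl : j = i := by omega
      simp at h2
  paired c b h := by
    simp only [List.cons_append, List.mem_cons, List.mem_append, List.mem_map, List.mem_reverse,
      Prod.mk.injEq] at h ⊢
    rcases h with ⟨rfl, rfl⟩ | ⟨rfl, rfl⟩ | ⟨j, hj, rfl, rfl⟩ | ⟨rfl, rfl⟩ | ⟨rfl, rfl⟩ |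
      ⟨j, hj, rfl, rfl⟩
    · simp
    · simp
    · exact Or.inr (Or.inr (Or.inr (Or.inr (Or.inr ⟨j, hj, rfl, rfl⟩))))
    · simp
    · simp
    · exact Or.inr (Or.inr (Or.inl ⟨j, hj, rfl, by simp⟩))

/-- The change gives crossings 0 and 1 opposite signs and opens the clasp by a second move. The
twist region, run through forwards and then backwards, is then a palindrome. -/
theorem twistClasp_null (r : ℕ) : ((twistClasp r).crossingChange {0}).Null := by
  have hw : ((twistClasp r).crossingChange {0}).word = [(0, false), (1, false)] ++
      (List.range (2 * r)).map (fun j => (j + 2, j % 2 == 0)) ++ ([(1, true), (0, true)] ++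
      ((List.range (2 * r)).map fun j => (j + 2, !(j % 2 == 0))).reverse) := by
    simp [twistClasp, LongDiagram.crossingChange, GaussDiagram.flip, Function.comp_def]
  refine .r2 _ 0 1 (by decide) (by simp [twistClasp, LongDiagram.crossingChange])
    (Or.inr ⟨_, _, (List.append_assoc _ _ _).trans hw.symm⟩)
    (Or.inl ⟨[], _, (List.append_assoc _ _ _).symm.trans hw.symm⟩) ?_
  refine LongDiagram.null_of_palindrome
    ((List.range (2 * r)).map (fun j => (j + 2, j % 2 == 0))) _ ?_
  have h : ∀ g : ℕ → Bool, ((List.range (2 * r)).map fun j => (j + 2, g j)).filter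
      (fun a => a.1 ∉ ({0, 1} : Finset ℕ)) = (List.range (2 * r)).map fun j => (j + 2, g j) :=
    fun g => List.filter_eq_self.2 fun a ha => by
      obtain ⟨j, -, rfl⟩ := List.mem_map.1 ha
      simp
  simp only [LongDiagram.virtualize, hw, List.filter_append, List.filter_reverse, h]
  simp [Function.comp_def]

open GaussDiagram

/-- `P` lists the colors on the first run through the twist region, `Q` those on the second run,
which goes from `2 * r` down to 0. At even `j` the first run is on top, at odd `j` the second one.
-/
theorem path_twistClasp {q r : ℕ} {f : ℕ × Bool → ZMod q} {u w : ZMod q} :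
    Path f ((foxSwitch q).rule (twistClasp r).sgn f) u (twistClasp r).word w ↔
      ∃ P Q : ℕ → ZMod q, f (0, true) = u ∧ f (1, false) = u ∧ P 0 = 2 * f (1, true) - u ∧
        f (1, true) = P (2 * r) ∧ f (0, false) = P (2 * r) ∧ Q (2 * r) = 2 * u - P (2 * r) ∧
        Q 0 = w ∧ ∀ j < 2 * r, f (j + 2, j % 2 == 0) = P j ∧ f (j + 2, !(j % 2 == 0)) = Q (j + 1) ∧
          P (j + 1) = (if j % 2 = 0 then P j else 2 * Q (j + 1) - P j) ∧
          Q j = if j % 2 = 0 then 2 * P j - Q (j + 1) else Q (j + 1) := by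
  have hr : ∀ c b, (foxSwitch q).rule (twistClasp r).sgn f (c, b) =
      if b then f (c, b) else 2 * f (c, !b) - f (c, b) := fun c b => rfl
  generalize (foxSwitch q).rule (twistClasp r).sgn f = ρ at hr
  simp only [twistClasp, path_append, List.cons_append, GaussDiagram.Path, path_map_range,
    path_map_range_reverse]
  constructor
  · rintro ⟨h1, h2, x, ⟨P, h3, rfl, h4⟩, h5, h6, Q, h7, h8, h9⟩
    simp only [hr, if_true, Bool.false_eq_true, if_false, Bool.not_false] at h2 h3 h6 h7
    refine ⟨P, Q, h1, h2.trans h1, ?_, h5, h6.trans h5, ?_, h8, fun j hj => ?_⟩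
    · rw [h3, h2, h1]
    · rw [h7, h6, h1, h5]
    · obtain ⟨a1, a2⟩ := h4 j hj
      obtain ⟨b1, b2⟩ := h9 j hj
      refine ⟨a1, b1, ?_⟩
      rw [← a2, ← b2, hr, hr, ← a1, ← b1]
      rcases Nat.mod_two_eq_zero_or_one j with h | h <;> simp [h]
  · rintro ⟨P, Q, h1, h2, h3, h5, h6, h7, h8, h⟩
    refine ⟨h1, ?_, _, ⟨P, ?_, rfl, fun j hj => ?_⟩, h5, ?_, Q, ?_, h8, fun j hj => ?_⟩
    · simp [hr, h1, h2]
    · simp [hr, h2, h3]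
    · obtain ⟨a, b, c, d⟩ := h j hj
      rw [c, hr, ← a, ← b]
      rcases Nat.mod_two_eq_zero_or_one j with h | h <;> simp [h]
    · simp [hr, h5, h6]
    · simp [hr, h7, h1, h6]
    · obtain ⟨a, b, c, d⟩ := h j hj
      rw [d, hr, ← a, ← b]
      rcases Nat.mod_two_eq_zero_or_one j with h | h <;> simp [h]

/-- Every two crossings of the twist region shift both colors by twice the difference `e = P 0 - w`.
The equations of the clasp then give `u = w` and `(4 * r + 1) * e = 0`; so `4 * r + 1` acts as the
determinant. -/
theorem twistClasp_constant {q r : ℕ} (h : ∀ x : ZMod q, (4 * r + 1) * x = 0 → x = 0)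
    {f : ℕ × Bool → ZMod q} {u w : ZMod q}
    (hf : Path f ((foxSwitch q).rule (twistClasp r).sgn f) u (twistClasp r).word w) :
    u = w ∧ ∀ a ∈ (twistClasp r).word, f a = u := by
  obtain ⟨P, Q, h1, h2, h3, h4, h5, h6, h7, h8⟩ := path_twistClasp.1 hf
  obtain ⟨e, he⟩ : ∃ e, e = P 0 - w := ⟨_, rfl⟩
  have key : ∀ i ≤ r, P (2 * i) = w + (2 * i + 1) * e ∧ Q (2 * i) = w + 2 * i * e := by
    intro i hi
    induction i with
    | zero => simp [h7, he]
    | succ i ih =>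
      obtain ⟨ih1, ih2⟩ := ih (by omega)
      obtain ⟨-, -, a1, a2⟩ := h8 (2 * i) (by omega)
      obtain ⟨-, -, b1, b2⟩ := h8 (2 * i + 1) (by omega)
      rw [if_pos (by omega)] at a1 a2
      rw [if_neg (by omega)] at b1 b2
      rw [show 2 * (i + 1) = 2 * i + 1 + 1 by ring, b1, ← b2]
      push_cast
      constructor
      · linear_combination 2 * a2 - a1 + 3 * ih1 - 2 * ih2
      · linear_combination a2 + 2 * ih1 - ih2
  obtain ⟨k1, k2⟩ := key r le_rfl
  have huw : u = w := by linear_combination k2 - h3 - 2 * h4 - he - k1 - h6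
  have he0 : e = 0 := h e (by linear_combination h6 - k1 - k2 + 2 * huw)
  have hP : ∀ i ≤ r, P (2 * i) = u ∧ Q (2 * i) = u := fun i hi => by
    simpa [he0, huw] using key i hi
  have hPQ : ∀ j < 2 * r, P j = u ∧ Q (j + 1) = u := by
    intro j hj
    obtain ⟨i, rfl | rfl⟩ := Nat.even_or_odd' j
    · obtain ⟨-, -, a1, a2⟩ := h8 (2 * i) (by omega)
      rw [if_pos (by omega)] at a2
      obtain ⟨b1, b2⟩ := hP i (by omega)
      exact ⟨b1, by linear_combination a2 + 2 * b1 - b2⟩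
    · obtain ⟨-, -, a1, a2⟩ := h8 (2 * i) (by omega)
      rw [if_pos (by omega)] at a1
      exact ⟨a1.trans (hP i (by omega)).1, (hP (i + 1) (by omega)).2⟩
  refine ⟨huw, fun a ha => ?_⟩
  simp only [twistClasp, List.cons_append, List.mem_cons, List.mem_append, List.mem_map,
    List.mem_reverse, List.mem_range] at ha
  rcases ha with rfl | rfl | ⟨j, hj, rfl⟩ | rfl | rfl | ⟨j, hj, rfl⟩
  · exact h1
  · exact h2
  · exact (h8 j hj).1.trans (hPQ j hj).1
  · exact h4.trans (hP r le_rfl).1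
  · exact h5.trans (hP r le_rfl).1
  · exact (h8 j hj).2.1.trans (hPQ j hj).2

/-- Fox colorings of `twistClasp r` with the color `v` at both ends. -/
def twistClaspColoring {q : ℕ} (r : ℕ) (v d : ZMod q) : ℕ × Bool → ZMod q
  | (0, true) => v
  | (1, false) => v
  | (1, true) => v + (2 * r + 1) * d
  | (0, false) => v + (2 * r + 1) * d
  | (j + 2, b) => if b = (j % 2 == 0) then v + (2 * (j / 2 : ℕ) + 1) * d
      else v + 2 * ((j + 2) / 2 : ℕ) * d

/-- The recurrence is solved by arithmetic progressions of step `2 * d`. The halves are rounded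
because a color changes only at every other crossing. Closing up at the clasp is the condition `hd`.
-/
theorem path_twistClasp_of_mul_eq_zero {q r : ℕ} (v : ZMod q) {d : ZMod q}
    (hd : (4 * r + 1) * d = 0) :
    Path (twistClaspColoring r v d)
      ((foxSwitch q).rule (twistClasp r).sgn (twistClaspColoring r v d)) v (twistClasp r).word v := by
  refine path_twistClasp.2 ⟨fun j => v + (2 * (j / 2 : ℕ) + 1) * d,
    fun j => v + 2 * ((j + 1) / 2 : ℕ) * d, rfl, rfl, ?_, ?_, ?_, ?_, ?_, fun j hj => ⟨?_, ?_, ?_, ?_⟩⟩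
  · simp only [twistClaspColoring]
    push_cast
    linear_combination -hd
  · simp [twistClaspColoring]
  · simp [twistClaspColoring]
  · have : (2 * r + 1) / 2 = r := by omega
    simp only [this, Nat.mul_div_cancel_left r (two_pos)]
    linear_combination hd
  · simp
  · simp [twistClaspColoring]
  · have : (j + 1 + 1) / 2 = (j + 2) / 2 := rfl
    simp [twistClaspColoring, this]
  · obtain ⟨i, rfl | rfl⟩ := Nat.even_or_odd' j
    · have h1 : (2 * i + 1) / 2 = i := by omega
      have h2 : 2 * i / 2 = i := by omega
      simp [h1, h2]
    · have h1 : (2 * i + 1) / 2 = i := by omega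
      have h2 : (2 * i + 1 + 1) / 2 = i + 1 := by omega
      have h3 : (2 * i + 1 + 1 + 1) / 2 = i + 1 := by omega
      rw [if_neg (by omega)]
      simp only [h1, h2, h3]
      push_cast
      ring
  · obtain ⟨i, rfl | rfl⟩ := Nat.even_or_odd' j
    · have h1 : (2 * i + 1) / 2 = i := by omega
      have h2 : 2 * i / 2 = i := by omega
      have h3 : (2 * i + 1 + 1) / 2 = i + 1 := by omega
      rw [if_pos (by omega)]
      simp only [h1, h2, h3]
      push_cast
      ring
    · have h2 : (2 * i + 1 + 1) / 2 = i + 1 := by omega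
      have h3 : (2 * i + 1 + 1 + 1) / 2 = i + 1 := by omega
      rw [if_neg (by omega)]
      simp only [h2, h3]

section Counts

variable {k : ℕ} {D : GaussDiagram k} {i₀ : Fin k} {N : ℕ} (hN : ∀ c ∈ D.crossings, c < N)

theorem count_le_count_insert_twistClasp (q r : ℕ) [NeZero q] :
    (foxSwitch q).count D ≤ (foxSwitch q).count (D.insert i₀ N hN (twistClasp r)) := by
  have := (foxSwitch q).mul_count_le_count_insert (Z := Unit) (i₀ := i₀) hN (twistClasp r)
    (fun v _ => twistClaspColoring r v 0)
    (fun v _ => path_twistClasp_of_mul_eq_zero v (mul_zero _)) fun _ _ _ _ => rfl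
  simpa using this

theorem mul_count_le_count_insert_twistClasp (r : ℕ) :
    (4 * r + 1) * (foxSwitch (4 * r + 1)).count D ≤
      (foxSwitch (4 * r + 1)).count (D.insert i₀ N hN (twistClasp r)) := by
  have h0 : (4 * r + 1 : ZMod (4 * r + 1)) = 0 := by exact_mod_cast ZMod.natCast_self (4 * r + 1)
  have := (foxSwitch (4 * r + 1)).mul_count_le_count_insert (i₀ := i₀) hN (twistClasp r)
    (twistClaspColoring r) (fun v d => path_twistClasp_of_mul_eq_zero v (by rw [h0, zero_mul]))
    fun v d d' h => ?_
  · rwa [Nat.card_zmod] at this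
  · have h1 := h (1, true) (by simp [twistClasp])
    simp only [twistClaspColoring, add_right_inj] at h1
    -- Modulo `4 * r + 1`, doubling `2 * r + 1` gives 1, so the color of the clasp determines `d`.
    linear_combination 2 * h1 - h0 * (d - d')

theorem count_insert_twistClasp (q r : ℕ) [NeZero q]
    (h : ∀ x : ZMod q, (4 * r + 1) * x = 0 → x = 0) :
    (foxSwitch q).count (D.insert i₀ N hN (twistClasp r)) = (foxSwitch q).count D :=
  le_antisymm ((foxSwitch q).count_insert_le hN _ fun _ _ _ => twistClasp_constant h)
    (count_le_count_insert_twistClasp hN q r)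

end Counts

/-! ### Bounds from colorings and diagrams of given flat index -/

namespace GaussDiagram

variable {k : ℕ}

/-- Equivalence of the flat virtual links that underlie the diagrams. -/
def FlatEquiv : GaussDiagram k → GaussDiagram k → Prop :=
  Relation.EqvGen fun D D' => Move D D' ∨ ∃ T, D' = D.crossingChange T

theorem FlatEquiv.trans {D D' D'' : GaussDiagram k} (h : D.FlatEquiv D')
    (h' : D'.FlatEquiv D'') : D.FlatEquiv D'' :=
  Relation.EqvGen.trans _ _ _ h h'

theorem FlatEquiv.of_equiv {D D' : GaussDiagram k} (h : D ≈ D') : D.FlatEquiv D' := by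
  induction h with
  | rel _ _ h => exact .rel _ _ (Or.inl h)
  | refl => exact .refl _
  | symm _ _ _ ih => exact .symm _ _ ih
  | trans _ _ _ _ _ ih ih' => exact ih.trans ih'

theorem flatEquiv_crossingChange (D : GaussDiagram k) (T : Finset ℕ) :
    D.FlatEquiv (D.crossingChange T) :=
  .rel _ _ (Or.inr ⟨T, rfl⟩)

theorem FlatEquiv.count_eq {D D' : GaussDiagram k} (h : D.FlatEquiv D') :
    flatSwitch.count D = flatSwitch.count D' := by
  induction h with
  | rel _ _ h =>
    obtain h | ⟨T, rfl⟩ := h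
    · exact flatSwitch.count_eq_of_move h
    · exact (flatSwitch.count_crossingChange_of_flat FlatSwitch.out_flat _ T).symm
  | refl => rfl
  | symm _ _ _ ih => exact ih.symm
  | trans _ _ _ _ _ ih ih' => exact ih.trans ih'

/-- Some diagram of the flat virtual link of `D` is trivialized by virtualizing `n` crossings. -/
def FlatUnknottable (D : GaussDiagram k) (n : ℕ) : Prop :=
  ∃ D', D.FlatEquiv D' ∧ ∃ S ⊆ D'.crossings, S.card = n ∧ D'.virtualize S ≈ trivial k

theorem FlatUnknottable.of_flatEquiv {D D' : GaussDiagram k} {n : ℕ} (h : D'.FlatUnknottable n)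
    (hD : D.FlatEquiv D') : D.FlatUnknottable n := by
  obtain ⟨D'', h', hS⟩ := h
  exact ⟨D'', hD.trans h', hS⟩

theorem Unknottable.flatUnknottable {D : GaussDiagram k} {n m : ℕ} (h : D.Unknottable n m) :
    D.FlatUnknottable n := by
  obtain ⟨S, T, hS, -, -, hn, -, h⟩ := h
  exact ⟨_, D.flatEquiv_crossingChange T, S, by rwa [crossings_crossingChange], hn, h⟩

/-- A flat crossing acts trivially once both incoming colors are 0; this condition takes values in
`F × F`, which has 16 elements. -/
theorem FlatUnknottable.count_le {D : GaussDiagram k} {n : ℕ} (h : D.FlatUnknottable n) :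
    flatSwitch.count D ≤ 16 ^ n * 4 ^ k := by
  obtain ⟨D', hD, S, -, rfl, hS⟩ := h
  have hV : Nat.card FlatSwitch.F = 4 := by simp
  rw [hD.count_eq, ← hV, ← flatSwitch.count_of_equiv_trivial hS]
  have h := flatSwitch.count_le_virtualize D' S (W := FlatSwitch.F × FlatSwitch.F)
    (fun x y => (x, y)) (fun _ _ _ _ => rfl) (by
      intro s b x y h
      have h0 : x = 0 ∧ y = 0 := by
        rcases h with h | h
        exacts [⟨congrArg Prod.fst h, congrArg Prod.snd h⟩,
          ⟨congrArg Prod.snd h, congrArg Prod.fst h⟩]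
      obtain ⟨rfl, rfl⟩ := h0
      rcases Int.units_eq_one_or s with rfl | rfl <;> cases b <;> rfl)
  rwa [Nat.card_prod, hV] at h

theorem count_fox_le_of_unknottable (q : ℕ) [NeZero q] {D : GaussDiagram k} {n m : ℕ}
    (h : D.Unknottable n m) : (foxSwitch q).count D ≤ q ^ (n + m + k) := by
  obtain ⟨S, T, -, -, -, rfl, rfl, h⟩ := h
  have hδ : ∀ x y x' y' : ZMod q, (x - x') - (y - y') = (x - y) - (x' - y') := by intros; ring
  have hout : ∀ (s : ℤˣ) (b : Bool) (x y : ZMod q), x - y = 0 ∨ y - x = 0 →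
      (foxSwitch q).out s b x y = x := by
    intro s b x y h
    have : x = y := by
      rcases h with h | h
      exacts [sub_eq_zero.1 h, (sub_eq_zero.1 h).symm]
    subst this
    cases b
    · change 2 * x - x = x
      ring
    · rfl
  have h1 := (foxSwitch q).count_le_crossingChange D T (fun x y => x - y) hδ hout
  have h2 := (foxSwitch q).count_le_virtualize (D.crossingChange T) S (fun x y => x - y) hδ hout
  rw [(foxSwitch q).count_of_equiv_trivial h] at h2
  rw [Nat.card_zmod] at h1 h2
  calc _ ≤ _ := h1
    _ ≤ _ := Nat.mul_le_mul_left _ h2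
    _ = _ := by ring

theorem exists_bound (D : GaussDiagram k) : ∃ N, ∀ c ∈ D.crossings, c < N :=
  ⟨D.crossings.sup id + 1, fun _ hc => Nat.lt_succ_of_le (Finset.le_sup (f := id) hc)⟩

theorem card_union_map {D : GaussDiagram k} {N : ℕ} (hN : ∀ c ∈ D.crossings, c < N)
    {S : Finset ℕ} (hS : S ⊆ D.crossings) :
    (S ∪ ({0} : Finset ℕ).map (addRightEmbedding N)).card = S.card + 1 := by
  rw [Finset.card_union_of_disjoint, Finset.card_map, Finset.card_singleton]
  simp only [Finset.map_singleton, Finset.disjoint_singleton_right, addRightEmbedding_apply]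
  intro h
  have := hN _ (hS h)
  omega

theorem union_map_subset {D : GaussDiagram k} {i₀ : Fin k} {N : ℕ} (hN : ∀ c ∈ D.crossings, c < N)
    {X : LongDiagram} {b : Bool} (hX : (0, b) ∈ X.word) {S : Finset ℕ} (hS : S ⊆ D.crossings) :
    S ∪ ({0} : Finset ℕ).map (addRightEmbedding N) ⊆ (D.insert i₀ N hN X).crossings := by
  refine Finset.union_subset (hS.trans (crossings_subset_insert hN X)) ?_
  simpa using mem_crossings_insert (i₀ := i₀) hN hX

theorem FlatUnknottable.exists_double (hk : 0 < k) {D : GaussDiagram k} {n : ℕ}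
    (h : D.FlatUnknottable n) : ∃ E : GaussDiagram k, E.FlatUnknottable (n + 1) ∧
      2 * flatSwitch.count D ≤ flatSwitch.count E := by
  obtain ⟨D', hD, S, hS, rfl, h⟩ := h
  obtain ⟨N, hN⟩ := D'.exists_bound
  refine ⟨D'.insert ⟨0, hk⟩ N hN flatClasp, ⟨_, .refl _, _,
    union_map_subset hN (b := true) (by decide) hS, card_union_map hN hS, ?_⟩, ?_⟩
  · rw [insert_virtualize hN _ hS]
    exact Setoid.trans (insert_equiv _ flatClasp_null) h
  · rw [hD.count_eq]
    exact two_mul_count_le_count_insert_flatClasp hN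

/-- If minimal value `n + 1` never occurred, every diagram trivialized by `n + 1` virtualizations
would need at most `n`. Flat clasps could then be inserted forever without raising the index above
`n`, although the flat count doubles each time. -/
theorem exists_flatUnknottable (hk : 0 < k) (n : ℕ) :
    ∃ D : GaussDiagram k, D.FlatUnknottable n ∧ ∀ a, D.FlatUnknottable a → n ≤ a := by
  induction n with
  | zero =>
    refine ⟨trivial k, ⟨trivial k, .refl _, ∅, Finset.empty_subset _, rfl, ?_⟩,
      fun _ _ => Nat.zero_le _⟩
    exact .rel _ _ (.iso _ _ (iso_of_word_eq (fun _ => rfl) fun _ _ => rfl))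
  | succ n ih =>
    by_contra! hcon
    obtain ⟨D, hD, -⟩ := ih
    have key : ∀ j, ∃ E : GaussDiagram k, (∃ a ≤ n, E.FlatUnknottable a) ∧
        2 ^ j ≤ flatSwitch.count E := by
      intro j
      induction j with
      | zero => exact ⟨D, ⟨n, le_rfl, hD⟩, flatSwitch.count_pos D⟩
      | succ j ih =>
        obtain ⟨E, ⟨a, ha, hE⟩, hj⟩ := ih
        obtain ⟨E', hE', h2⟩ := hE.exists_double hk
        refine ⟨E', ?_, ?_⟩
        · rcases Nat.lt_or_ge a n with h | h
          · exact ⟨a + 1, h, hE'⟩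
          · obtain rfl : a = n := le_antisymm ha h
            obtain ⟨b, hb, hlt⟩ := hcon E' hE'
            exact ⟨b, by omega, hb⟩
        · rw [pow_succ']
          exact (Nat.mul_le_mul_left 2 hj).trans h2
    -- Taking the bound itself as exponent suffices, since `j < 2 ^ j`.
    obtain ⟨E, ⟨a, ha, hE⟩, hj⟩ := key (16 ^ n * 4 ^ k)
    have h1 := hE.count_le
    have h2 : 16 ^ a * 4 ^ k ≤ 16 ^ n * 4 ^ k :=
      Nat.mul_le_mul_right _ (Nat.pow_le_pow_right (by norm_num) ha)
    exact absurd (hj.trans (h1.trans h2)) (not_le.2 Nat.lt_two_pow_self)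

theorem Unknottable.insert_twistClasp {D : GaussDiagram k} {i₀ : Fin k} {N : ℕ}
    (hN : ∀ c ∈ D.crossings, c < N) (r : ℕ) {n m : ℕ} (h : D.Unknottable n m) :
    (D.insert i₀ N hN (twistClasp r)).Unknottable n (m + 1) := by
  obtain ⟨S, T, hS, hT, hST, rfl, rfl, h⟩ := h
  have hX : (0, true) ∈ (twistClasp r).word := by simp [twistClasp]
  refine ⟨S, T ∪ ({0} : Finset ℕ).map (addRightEmbedding N),
    hS.trans (crossings_subset_insert hN _), union_map_subset hN hX hT, ?_, rfl,
    card_union_map hN hT, ?_⟩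
  · rw [Finset.disjoint_union_right]
    refine ⟨hST, ?_⟩
    simp only [Finset.map_singleton, Finset.disjoint_singleton_right, addRightEmbedding_apply]
    intro h
    have := hN _ (hS h)
    omega
  · rw [insert_crossingChange hN _ hT]
    have h1 := insert_virtualize (i₀ := i₀) (lt_of_mem_crossings_crossingChange hN T)
      ((twistClasp r).crossingChange {0}) (S := S) (by rwa [crossings_crossingChange]) ∅
    rw [Finset.map_empty, Finset.union_empty] at h1
    rw [h1]
    have h2 : ((twistClasp r).crossingChange {0}).virtualize ∅ =
        (twistClasp r).crossingChange {0} := by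
      simp [LongDiagram.virtualize]
    rw [h2]
    exact Setoid.trans (insert_equiv _ (twistClasp_null r)) h

/-- Crossing changes are free in the flat class, and one of them dissolves the inserted clasp; hence
twisted clasps leave the first entry of the index bounded below as before. -/
theorem flatEquiv_insert_twistClasp {D : GaussDiagram k} {i₀ : Fin k} {N : ℕ}
    (hN : ∀ c ∈ D.crossings, c < N) (r : ℕ) :
    D.FlatEquiv (D.insert i₀ N hN (twistClasp r)) := by
  refine .symm _ _ (.trans _ _ _ (flatEquiv_crossingChange _
    (∅ ∪ ({0} : Finset ℕ).map (addRightEmbedding N))) ?_)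
  rw [insert_crossingChange hN _ (Finset.empty_subset _)]
  exact (FlatEquiv.of_equiv (insert_equiv _ (twistClasp_null r))).trans
    (.symm _ _ (flatEquiv_crossingChange D ∅))

end GaussDiagram

/-! ### The unknotting index and the infinite family -/

namespace VirtualLink

open GaussDiagram

variable {k : ℕ}

theorem mk_eq_mk {D D' : GaussDiagram k} : mk D = mk D' ↔ D ≈ D' := Quotient.eq

theorem exists_unknottable (L : VirtualLink k) : ∃ D, mk D = L ∧
    D.Unknottable (ofLex L.unknottingIndex).1 (ofLex L.unknottingIndex).2 := by
  obtain ⟨D, hD, h⟩ : L.unknottingIndex ∈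
      {p | ∃ D : GaussDiagram k, mk D = L ∧ D.unknottingIndex = p} := WellFounded.min_mem _ _ _
  have h' : D.unknottingIndex ∈ {p : ℕ ×ₗ ℕ | D.Unknottable (ofLex p).1 (ofLex p).2} :=
    WellFounded.min_mem _ _ _
  rw [h] at h'
  exact ⟨D, hD, h'⟩

theorem unknottingIndex_le {D : GaussDiagram k} {n m : ℕ} (h : D.Unknottable n m) :
    (mk D).unknottingIndex ≤ toLex (n, m) := by
  have h1 : (mk D).unknottingIndex ≤ D.unknottingIndex :=
    not_lt.1 (WellFounded.not_lt_min wellFounded_lt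
      {p | ∃ D' : GaussDiagram k, mk D' = mk D ∧ D'.unknottingIndex = p} ⟨D, rfl, rfl⟩)
  have h2 : D.unknottingIndex ≤ toLex (n, m) :=
    not_lt.1 (WellFounded.not_lt_min wellFounded_lt
      {p : ℕ ×ₗ ℕ | D.Unknottable (ofLex p).1 (ofLex p).2} h)
  exact h1.trans h2

end VirtualLink

open GaussDiagram

/-- The continuity argument for the second entry: if `(n, m)` were always skipped, clasps could be
inserted forever while the second entry stays below `m`, against the bound on Fox colorings modulo
`p`. -/
theorem exists_unknottingIndex_eq {n m k : ℕ} (hm : 0 < m) (hk : 0 < k) {D : GaussDiagram k}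
    (hD : D.Unknottable n 0) (hD' : ∀ a, D.FlatUnknottable a → n ≤ a) {p : ℕ} (hp : p.Prime)
    (hp4 : p % 4 = 1) : ∃ E : GaussDiagram k, (VirtualLink.mk E).unknottingIndex = toLex (n, m) ∧
      p * (foxSwitch p).count D ≤ (foxSwitch p).count E ∧
      ∀ q, q.Prime → q ≠ p → (foxSwitch q).count E = (foxSwitch q).count D := by
  by_contra! hcon
  have : NeZero p := ⟨hp.ne_zero⟩
  obtain ⟨r, rfl⟩ : ∃ r, p = 4 * r + 1 := ⟨p / 4, by omega⟩
  have key : ∀ j, ∃ E : GaussDiagram k, D.FlatEquiv E ∧ (∃ b < m, E.Unknottable n b) ∧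
      (4 * r + 1) ^ j * (foxSwitch (4 * r + 1)).count D ≤ (foxSwitch (4 * r + 1)).count E ∧
      ∀ q, q.Prime → q ≠ 4 * r + 1 → (foxSwitch q).count E = (foxSwitch q).count D := by
    intro j
    induction j with
    | zero => exact ⟨D, .refl _, ⟨0, hm, hD⟩, by simp, fun _ _ _ => rfl⟩
    | succ j ih =>
      obtain ⟨E, hDE, ⟨b, hb, hE⟩, hj, hq⟩ := ih
      obtain ⟨N, hN⟩ := E.exists_bound
      set E' := E.insert ⟨0, hk⟩ N hN (twistClasp r) with hE'
      have hle : (VirtualLink.mk E').unknottingIndex ≤ toLex (n, m) :=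
        (VirtualLink.unknottingIndex_le (hE.insert_twistClasp hN r)).trans
          (Prod.Lex.toLex_le_toLex.2 (by simpa using Nat.succ_le_of_lt hb))
      have hpj : (4 * r + 1) ^ (j + 1) * (foxSwitch (4 * r + 1)).count D ≤
          (foxSwitch (4 * r + 1)).count E' := by
        rw [pow_succ', mul_assoc]
        exact (Nat.mul_le_mul_left _ hj).trans (mul_count_le_count_insert_twistClasp hN r)
      have hq' : ∀ q, q.Prime → q ≠ 4 * r + 1 →
          (foxSwitch q).count E' = (foxSwitch q).count D := by
        intro q hqp hqr
        have : Fact q.Prime := ⟨hqp⟩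
        rw [← hq q hqp hqr]
        refine count_insert_twistClasp hN q r fun x hx => ?_
        refine (mul_eq_zero.1 hx).resolve_left fun h => hqr ?_
        have h' : ((4 * r + 1 : ℕ) : ZMod q) = 0 := by exact_mod_cast h
        rw [ZMod.natCast_eq_zero_iff] at h'
        exact (Nat.prime_dvd_prime_iff_eq hqp hp).1 h'
      -- The induction continues with a diagram of the same link that attains the index; counts and
      -- flat class do not change.
      obtain ⟨E'', hmk, hE''⟩ := (VirtualLink.mk E').exists_unknottable
      have hequiv : E' ≈ E'' := VirtualLink.mk_eq_mk.1 hmk.symm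
      have hflat : D.FlatEquiv E'' :=
        hDE.trans ((flatEquiv_insert_twistClasp hN r).trans (.of_equiv hequiv))
      have hcount : ∀ q, [NeZero q] → (foxSwitch q).count E'' = (foxSwitch q).count E' :=
        fun q _ => ((foxSwitch q).count_eq_of_equiv hequiv).symm
      have hn : n ≤ (ofLex (VirtualLink.mk E').unknottingIndex).1 :=
        hD' _ (hE''.flatUnknottable.of_flatEquiv hflat)
      have hne : (VirtualLink.mk E').unknottingIndex ≠ toLex (n, m) := by
        intro h
        -- `E'` already has the required Fox counts, so by `hcon` its index is not `(n, m)`. Being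
        -- at most `(n, m)` with first entry at least `n`, it has first entry `n` and second entry
        -- below `m`.
        obtain ⟨q, h1, h2, h3⟩ := hcon E' h (le_trans (Nat.mul_le_mul_right _
          (Nat.le_self_pow (Nat.succ_ne_zero j) _)) hpj)
        exact h3 (hq' q h1 h2)
      have hlt := Prod.Lex.lt_iff.1 (lt_of_le_of_ne hle hne)
      simp only [ofLex_toLex] at hlt
      obtain ⟨h1, h2⟩ : (ofLex (VirtualLink.mk E').unknottingIndex).1 = n ∧
          (ofLex (VirtualLink.mk E').unknottingIndex).2 < m := by
        rcases hlt with h | h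
        · exact absurd h (not_lt.2 hn)
        · exact h
      rw [h1] at hE''
      refine ⟨E'', hflat, ⟨_, h2, hE''⟩, by rwa [hcount], fun q h3 h4 => ?_⟩
      have : NeZero q := ⟨h3.ne_zero⟩
      rw [hcount, hq' q h3 h4]
  -- With this many clasps the Fox count is at least `p ^ (n + m + k)`, above the bound `p ^ (n + b
  -- + k)` for `b < m`.
  obtain ⟨E, -, ⟨b, hb, hE⟩, hj, -⟩ := key (n + m + k)
  have h1 := count_fox_le_of_unknottable (4 * r + 1) hE
  have h2 : (4 * r + 1) ^ (n + b + k) < (4 * r + 1) ^ (n + m + k) :=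
    Nat.pow_lt_pow_right hp.one_lt (by omega)
  have h3 := Nat.le_mul_of_pos_right ((4 * r + 1) ^ (n + m + k))
    ((foxSwitch (4 * r + 1)).count_pos D)
  omega

theorem mainTheorem5 (n m k : ℕ) (hn : 0 < n) (hm : 0 < m) (hk : 0 < k) :
    {L : VirtualLink k | L.unknottingIndex = toLex (n, m)}.Infinite := by
  -- `D` replaces `D₀` within the same flat class: it is trivialized by `n` virtualizations with no
  -- crossing change, and minimality depends only on the flat class.
  obtain ⟨D₀, ⟨D, hD, S, hS, hcard, hDS⟩, hmin⟩ := exists_flatUnknottable hk n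
  have hU : D.Unknottable n 0 := by
    refine ⟨S, ∅, hS, Finset.empty_subset _, Finset.disjoint_empty_right _, hcard, rfl, ?_⟩
    have : D.crossingChange ∅ = D := by
      refine eq_of_word_eq (fun i => ?_) (funext fun c => by simp [crossingChange])
      refine (List.map_congr_left fun a _ => ?_).trans (List.map_id _)
      simp [GaussDiagram.flip]
    rwa [this]
  have hinf : {p : ℕ | p.Prime ∧ p ≡ 1 [MOD 4]}.Infinite :=
    Nat.infinite_setOfPred_prime_modEq_one four_ne_zero
  have h4 : ∀ p : {p : ℕ | p.Prime ∧ p ≡ 1 [MOD 4]}, p.1 % 4 = 1 := fun p => p.2.2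
  choose E hE hEp hEq using fun p : {p : ℕ | p.Prime ∧ p ≡ 1 [MOD 4]} =>
    exists_unknottingIndex_eq hm hk hU (fun a ha => hmin a (ha.of_flatEquiv hD)) p.2.1 (h4 p)
  have := hinf.to_subtype
  refine Set.infinite_of_injective_forall_mem (f := fun p => VirtualLink.mk (E p))
    (fun p q hpq => ?_) hE
  by_contra hne
  have : NeZero p.1 := ⟨p.2.1.ne_zero⟩
  have h1 := (foxSwitch p).count_eq_of_equiv (VirtualLink.mk_eq_mk.1 hpq)
  -- Modulo `p`, the link of `q` has as many Fox colorings as `D`, the link of `p` at least `p`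
  -- times as many.
  rw [hEq q p p.2.1 (fun h => hne (Subtype.ext h))] at h1
  have h2 := hEp p
  rw [h1] at h2
  have h3 := (foxSwitch p).count_pos D
  have h5 := p.2.1.two_le
  nlinarith
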